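/- **Setting.** Let $\mathcal S$ (shocks) and $\mathcal A$ (actions) be finite sets and $\mathcal X$ (states) a countable set. Let $\pi(s'|s)>0$ be transition probabilities on $\mathcal S$, $0<\beta<1$, $\zeta:\mathcal X\times\mathcal A\times\mathcal S\to\mathcal X$, $p:\mathcal X\times\mathcal A\times\mathcal S\to\mathbb R$, and let $r,g^1,\dots,g^I,\bar g^1,\dots,\bar g^I:\mathcal X\times\mathcal A\times\mathcal S\to\mathbb R$ be bounded (in particular the $\bar g^i$ may be constants). Let $\tilde{\mathcal A}(x,s)=\{a\in\mathcal A: p(x,a,s)\ge 0\}$. A plan $a=(a(s^t))$ assigns an action to each shock history $s^t=(s_0,\dots,s_t)\in\mathcal S^{t+1}$, $t\ge 0$. From $x_0$ it generates $x(s^0)=x_0$, $x(s^{t+1})=\zeta(x(s^t),a(s^t),s_t)$. We write $x_t=x(s^t)$ and $a_t=a(s^t)$. Let $\tilde{\mathcal A}^\infty(x_0)$ be the set of plans with $a(s^t)\in\tilde{\mathcal A}(x(s^t),s_t)$ for all $t,s^t$, with the product $\sigma$-algebra, and put $$G^i_{s^t}(a)=\mathbb E_{s^t}\sum_{n=0}^\infty\beta^n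 g^i(x_{t+n},a_{t+n},s_{t+n})-\bar g^i(x_t,a_t,s_t).$$ A plan $a\in\tilde{\mathcal A}^\infty(x_0)$ is *feasible* at $x_0$ if $G^i_{s^t}(a)\ge 0$ for all $i,t,s^t$. Assume that for every $x_0\in\mathcal X$ there is a feasible plan. **Ex-post lottery problem.** For $\gamma\in\mathbb R_+^I$, $x_0\in\mathcal X$, $s_0\in\mathcal S$, maximize $$\int \mathbb E_{s_0}\sum_{t=0}^\infty\beta^t\Big(r(x_t,a_t,s_t)+\sum_{i=1}^I\gamma^i g^i(x_t,a_t,s_t)\Big)\,dP(a)$$ over the probability measures $P$ on $\tilde{\mathcal A}^\infty(x_0)$ such that, for every $i$, $t$ and every post-action history $\tilde h^t=(s_0,\tilde a_0,\dots,s_t,\tilde a_t)\in\mathcal S^{t+1}\times\mathcal A^{t+1}$, $$\int 1_{\{(a(s^0),\dots,a(s^t))=(\tilde a_0,\dots,\tilde a_t)\}}\,G^i_{s^t}(a)\,dP(a)\ge 0 .$$ **Dual value.** Let $\tilde\Lambda(s_0)$ be the set of nonnegative multipliers $\lambda^i(\tilde h^t)$ with $\sum_t\sum_{\tilde h^t}\sum_i\beta^t\lambda^i(\tilde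 h^t)\pi^t(s^t|s_0)<\infty$, where $\pi^t(s^t|s_0)$ is the probability of the history $s^t$ when the initial shock is $s_0$. Let $$\tilde D(\gamma,x_0,s_0)=\inf_{\lambda\in\tilde\Lambda(s_0)}\ \sup_{a\in\tilde{\mathcal A}^\infty(x_0)}\ \mathbb E_{s_0}\sum_{t=0}^\infty\beta^t\Big(r(x_t,a_t,s_t)+\sum_i\gamma^i g^i(x_t,a_t,s_t)+\sum_i\lambda^i(\tilde h^t)\,G^i_{s^t}(a)\Big),$$ where $\tilde h^t$ is the history of shocks and actions realized under $a$. **Sup-inf functional equation.** For $F:\mathbb R_+^I\times\mathcal X\times\mathcal S\to\mathbb R$, with $x'=\zeta(x,a,s)$, $$F(\gamma,x,s)=\sup_{a\in\tilde{\mathcal A}(x,s)}\ \inf_{\lambda\in\mathbb R_+^I}\Big[r(x,a,s)+\sum_i\big(\gamma^i g^i(x,a,s)+\lambda^i(g^i(x,a,s)-\bar g^i(x,a,s))\big)+\beta\sum_{s'}\pi(s'|s)F(\gamma+\lambda,x',s')\Big].\tag{FE}$$ **The class $\mathcal N$.** Let $L=(\|r\|_\infty+\sum_i\|g^i\|_\infty)/(1-\beta)$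 and $B(k)=\{\gamma\in\mathbb R_+^I:\|\gamma\|_\infty\le k\}$. Fix enumerations $(s_i)$ of $\mathcal S$ and $(x_j)$ of $\mathcal X$. $\mathcal N$ is the set of $F:\mathbb R_+^I\times\mathcal X\times\mathcal S\to\mathbb R$ with $F(\cdot,x,s)\in L^\infty(B(k))$ for all $k\ge1,x,s$ and $\sum_i2^{-i}\sum_j2^{-j}\sum_k2^{-k}\|F(\cdot,x_j,s_i)\|_{L^\infty(B(k))}<\infty$, such that for all $x,s$: $F(\cdot,x,s)$ is convex; $F(\cdot,x,s)$ is $L$-Lipschitz for the $\ell^1$-norm; $F(\gamma,x,s)\ge \mathbb E_{s_0=s}\sum_t\beta^t r(x_t,a_t,s_t)+\sum_i\gamma^i\,\mathbb E_{s_0=s}\sum_t\beta^t g^i(x_t,a_t,s_t)$ for every $\gamma$ and every plan $a$ feasible at $x_0=x$; and $F(\gamma,x,s)\le(1+\sum_i\gamma^i)L$ for every $\gamma$. **Theorem.** (1) For all $\gamma\in\mathbb R_+^I$, $x_0\in\mathcal X$, $s_0\in\mathcal S$, the ex-post lottery problem has a maximum $V(\gamma,x_0,s_0)\in\mathbb R$,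 it is attained, and $V(\gamma,x_0,s_0)=\tilde D(\gamma,x_0,s_0)$. (2) Among the solutions of (FE) in $\mathcal N$ there is a (pointwise) largest one, $F^*$, and $F^*(\gamma,x_0,s_0)$ is the maximum of the ex-post lottery problem for all $\gamma,x_0,s_0$. -/

import Mathlib

open scoped NNReal ENNReal
open MeasureTheory

noncomputable section

namespace ForwardLooking

/-- The data of a dynamic planning problem with `I` forward looking constraints: shocks in `S`,
actions in `A`, physical states in `X`.  The threshold `gbar i` may depend on the current state,
action and shock; a constant threshold is the special case of a constant function. -/
structure Model (S A X : Type*) (I : ℕ) where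
  /-- transition probabilities: `π s s'` is the probability of moving from `s` to `s'` -/
  π : S → S → ℝ
  /-- discount factor -/
  β : ℝ
  /-- law of motion of the physical state -/
  ζ : X → A → S → X
  /-- the action `a` is allowed at `(x, s)` if and only if `0 ≤ p x a s` -/
  p : X → A → S → ℝ
  /-- current return -/
  r : X → A → S → ℝ
  /-- current terms of the forward looking constraints -/
  g : Fin I → X → A → S → ℝ
  /-- thresholds of the forward looking constraints -/
  gbar : Fin I → X → A → S → ℝ

/-- An action plan `(a(s^t))`.  A shock history `s^t = (s_0, …, s_t)` is given as a pair
`past, s`, where `s = s_t` and `past = [s_{t-1}, …, s_0]` lists the earlier shocks, **most recent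
first**; so `a past s` is the action `a(s^t)`. -/
abbrev Plan (S A : Type*) : Type _ := List S → S → A

namespace Model

variable {S A X : Type*} {I : ℕ}

/-- The physical state `x(s^t)` generated by the plan `a` from `x₀`; it depends on
`s_0, …, s_{t-1}` only. -/
def state (M : Model S A X I) (a : Plan S A) (x₀ : X) : List S → X
  | [] => x₀
  | s :: past => M.ζ (M.state a x₀ past) (a past s) s

/-- The set of allowed actions at `(x, s)`. -/
def allowed (M : Model S A X I) (x : X) (s : S) : Set A := {a | 0 ≤ M.p x a s}

/-- The set `Ã^∞(x₀)` of plans that take an allowed action after every shock history. -/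
def admissible (M : Model S A X I) (x₀ : X) : Set (Plan S A) :=
  {a | ∀ past s, a past s ∈ M.allowed (M.state a x₀ past) s}

/-- `E[f(s^{t+n}) | s^t]`, where `s^t` is the history `past, s`. -/
def expAfter [Fintype S] (M : Model S A X I) (f : List S → S → ℝ) : ℕ → List S → S → ℝ
  | 0, past, s => f past s
  | n + 1, past, s => ∑ s', M.π s s' * M.expAfter f n (s :: past) s'

/-- `E[∑_{n ≥ 0} β^n f(s^{t+n}) | s^t]`, where `s^t` is the history `past, s`. -/
def discounted [Fintype S] (M : Model S A X I) (f : List S → S → ℝ) (past : List S) (s : S) : ℝ :=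
  ∑' n : ℕ, M.β ^ n * M.expAfter f n past s

/-- The value of a function of state, action and shock along a plan. -/
def along (M : Model S A X I) (f : X → A → S → ℝ) (a : Plan S A) (x₀ : X) : List S → S → ℝ :=
  fun past s => f (M.state a x₀ past) (a past s) s

/-- `E_{s^t} ∑_{n ≥ 0} β^n g^i(x(s^{t+n}), a(s^{t+n}), s_{t+n}) - gbar^i(x(s^t), a(s^t), s_t)`. -/
def slack [Fintype S] (M : Model S A X I) (i : Fin I) (a : Plan S A) (x₀ : X)
    (past : List S) (s : S) : ℝ :=
  M.discounted (M.along (M.g i) a x₀) past s - M.along (M.gbar i) a x₀ past s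

/-- The current payoff `r + ∑ i, γ^i g^i`. -/
def payoff (M : Model S A X I) (γ : Fin I → ℝ≥0) (x : X) (a : A) (s : S) : ℝ :=
  M.r x a s + ∑ i, (γ i : ℝ) * M.g i x a s

/-- The objective `E_{s₀} ∑ β^t (r + ∑ i, γ^i g^i)` of a plan. -/
def objective [Fintype S] (M : Model S A X I) (γ : Fin I → ℝ≥0) (x₀ : X) (s₀ : S)
    (a : Plan S A) : ℝ :=
  M.discounted (M.along (M.payoff γ) a x₀) [] s₀

/-- Feasibility of a plan in the deterministic (lottery-free) problem: all actions are allowed and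
all forward looking constraints hold, after every shock history. -/
def Feasible [Fintype S] (M : Model S A X I) (x₀ : X) (a : Plan S A) : Prop :=
  a ∈ M.admissible x₀ ∧ ∀ i past s, 0 ≤ M.slack i a x₀ past s

/-- The standing assumptions.  (`S` finite, `A` finite and `X` countable are assumed separately.
Boundedness of `gbar` is automatic for constant thresholds.) -/
structure Assumptions [Fintype S] (M : Model S A X I) : Prop where
  π_pos : ∀ s s', 0 < M.π s s'
  π_sum : ∀ s, ∑ s', M.π s s' = 1
  r_bdd : ∃ C : ℝ, ∀ x a s, |M.r x a s| ≤ C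
  g_bdd : ∀ i, ∃ C : ℝ, ∀ x a s, |M.g i x a s| ≤ C
  gbar_bdd : ∀ i, ∃ C : ℝ, ∀ x a s, |M.gbar i x a s| ≤ C
  β_pos : 0 < M.β
  β_lt_one : M.β < 1
  feasible : ∀ x₀ : X, ∃ a, M.Feasible x₀ a

/-! ### The ex-post lottery problem -/

/-- The shocks and actions realized along `past` under the plan `a`, most recent first. -/
def realized (a : Plan S A) : List S → List (S × A)
  | [] => []
  | s :: past => (s, a past s) :: realized a past

/-- A post-action history `h̃^t = (s_0, ã_0, …, s_t, ã_t)` is given as `past, s, b`, where `s = s_t`,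
`b = ã_t` and `past = [(s_{t-1}, ã_{t-1}), …, (s_0, ã_0)]`.  `Follows a past s b` says that, along
the shocks of `h̃^t`, the plan `a` takes exactly the actions `ã_0, …, ã_t`. -/
def Follows (a : Plan S A) (past : List (S × A)) (s : S) (b : A) : Prop :=
  realized a (past.map Prod.fst) = past ∧ a (past.map Prod.fst) s = b

open Classical in
/-- Feasibility of a lottery over admissible plans in the ex-post problem: for every post-action
history `h̃^t` and every `i`,
`E^{a ∼ P}_{s^t} 1_{ã^t = a^t} (∑_{n ≥ 0} β^n g^i(x_{t+n}, a_{t+n}, s_{t+n}) - gbar^i) ≥ 0`. -/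
def ExPostFeasible [Fintype S] [MeasurableSpace A] (M : Model S A X I) (x₀ : X)
    (P : ProbabilityMeasure (M.admissible x₀)) : Prop :=
  ∀ (i : Fin I) (past : List (S × A)) (s : S) (b : A),
    0 ≤ ∫ a : M.admissible x₀,
      (if Follows a.1 past s b then M.slack i a.1 x₀ (past.map Prod.fst) s else 0)
        ∂(P : Measure (M.admissible x₀))

/-- The set of values of the objective at the feasible lotteries of the ex-post problem. -/
def exPostValues [Fintype S] [MeasurableSpace A] (M : Model S A X I) (γ : Fin I → ℝ≥0)
    (x₀ : X) (s₀ : S) : Set ℝ :=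
  {v | ∃ P : ProbabilityMeasure (M.admissible x₀), M.ExPostFeasible x₀ P ∧
    v = ∫ a : M.admissible x₀, M.objective γ x₀ s₀ a.1 ∂(P : Measure (M.admissible x₀))}

/-! ### The dual value function -/

open Classical in
/-- The probability `π^t(s^t | s₀)` of the history `s^t` given as `past, s`. -/
def histProb (M : Model S A X I) (s₀ : S) : List S → S → ℝ
  | [], s => if s = s₀ then 1 else 0
  | s' :: past, s => M.histProb s₀ past s' * M.π s' s

/-- Nonnegative multipliers `μ^i(h̃^t)` that depend on post-action histories. -/
abbrev Multiplier (S A : Type*) (I : ℕ) : Type _ := List (S × A) → S → A → Fin I → ℝ≥0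

/-- The set of multipliers with
`∑_t ∑_{h̃^t} ∑_i β^t μ^i(h̃^t) π^t(s^t | s₀) < ∞` (a sum of nonnegative terms). -/
def summableMultipliers (M : Model S A X I) (s₀ : S) : Set (Multiplier S A I) :=
  {μ | Summable fun h : List (S × A) × S × A × Fin I =>
    M.β ^ h.1.length * (μ h.1 h.2.1 h.2.2.1 h.2.2.2 : ℝ) *
      M.histProb s₀ (h.1.map Prod.fst) h.2.1}

/-- The Lagrangian
`E_{s₀} ∑_t β^t (r + ∑ i, γ^i g^i + ∑ i, μ^i(h̃^t) (∑_n β^n g^i(x_{t+n}, a_{t+n}, s_{t+n}) - gbar^i))`,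
where `h̃^t` is the post-action history realized under the plan `a`. -/
def lagrangian [Fintype S] (M : Model S A X I) (γ : Fin I → ℝ≥0) (x₀ : X) (s₀ : S)
    (a : Plan S A) (μ : Multiplier S A I) : ℝ :=
  M.discounted (fun past s => M.along (M.payoff γ) a x₀ past s +
    ∑ i, (μ (realized a past) s (a past s) i : ℝ) * M.slack i a x₀ past s) [] s₀

/-- The dual value `D̃(γ, x₀, s₀)`: the infimum over multipliers of the supremum over admissible
plans of the Lagrangian, as an extended real number. -/
def dualValue [Fintype S] (M : Model S A X I) (γ : Fin I → ℝ≥0) (x₀ : X) (s₀ : S) : EReal :=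
  ⨅ μ ∈ (M.summableMultipliers s₀ : Set (Multiplier S A I)),
    ⨆ a ∈ M.admissible x₀, (M.lagrangian γ x₀ s₀ a μ : EReal)

/-! ### The sup-inf functional equation -/

/-- `F` solves the sup-inf functional equation.  The inner infimum may be `-∞` for some allowed
actions, so that the equation is one between extended real numbers. -/
def SolvesSupInf [Fintype S] (M : Model S A X I) (F : (Fin I → ℝ≥0) → X → S → ℝ) : Prop :=
  ∀ γ x s, (F γ x s : EReal) = ⨆ a ∈ M.allowed x s, ⨅ l : Fin I → ℝ≥0,
    ((M.r x a s
      + ∑ i, ((γ i : ℝ) * M.g i x a s + (l i : ℝ) * (M.g i x a s - M.gbar i x a s))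
      + M.β * ∑ s', M.π s s' * F (γ + l) (M.ζ x a s) s' : ℝ) : EReal)

/-- The supremum norm of a (bounded) function of state, action and shock. -/
def supNorm (f : X → A → S → ℝ) : ℝ := ⨆ z : X × A × S, |f z.1 z.2.1 z.2.2|

/-- `L = (‖r‖_∞ + ∑ i, ‖g^i‖_∞) / (1 - β)`. -/
def lipConst (M : Model S A X I) : ℝ :=
  (supNorm M.r + ∑ i, supNorm (M.g i)) / (1 - M.β)

/-- The box `B(k) = {γ ∈ ℝ_+^I : ‖γ‖_∞ ≤ k}`. -/
def box (I k : ℕ) : Set (Fin I → ℝ≥0) := {γ | ∀ i, γ i ≤ k}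

/-- Lebesgue measure on `ℝ_+^I`. -/
def orthantVolume (I : ℕ) : Measure (Fin I → ℝ≥0) :=
  Measure.comap (fun γ i => (γ i : ℝ)) (volume : Measure (Fin I → ℝ))

/-- An enumeration of a countable set. -/
def enumIndex (T : Type*) [Countable T] : T → ℕ := (exists_injective_nat T).choose

/-- The weighted sum
`∑_i 2^{-i} ∑_j 2^{-j} ∑_k 2^{-k} ‖F(·, x_j, s_i)‖_{L^∞(B(k))}`, with `i`, `j`, `k` starting at one. -/
def weightedNorm [Fintype S] [Countable X] (F : (Fin I → ℝ≥0) → X → S → ℝ) : ℝ≥0∞ :=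
  ∑ s, (2⁻¹ : ℝ≥0∞) ^ (enumIndex S s + 1) *
    ∑' x, (2⁻¹ : ℝ≥0∞) ^ (enumIndex X x + 1) *
      ∑' k : ℕ, (2⁻¹ : ℝ≥0∞) ^ (k + 1) *
        eLpNorm (fun γ => F γ x s) ∞ ((orthantVolume I).restrict (box I (k + 1)))

/-- The space `𝓜` of functions that are essentially bounded on every box and have a finite
weighted norm. -/
def spaceM (S X : Type*) (I : ℕ) [Fintype S] [Countable X] :
    Set ((Fin I → ℝ≥0) → X → S → ℝ) :=
  {F | (∀ (k : ℕ) x s, MemLp (fun γ => F γ x s) ∞ ((orthantVolume I).restrict (box I (k + 1)))) ∧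
    weightedNorm F < ∞}

/-- The set `𝓝 ⊆ 𝓜`. -/
structure InN [Fintype S] [Countable X] (M : Model S A X I)
    (F : (Fin I → ℝ≥0) → X → S → ℝ) : Prop where
  mem_spaceM : F ∈ spaceM S X I
  convex : ∀ x s, ConvexOn ℝ≥0 Set.univ (fun γ => F γ x s)
  lipschitz : ∀ x s γ γ', |F γ x s - F γ' x s| ≤ M.lipConst * ∑ i, |(γ i : ℝ) - (γ' i : ℝ)|
  lower : ∀ γ x s a, M.Feasible x a →
    M.discounted (M.along M.r a x) [] s
      + ∑ i, (γ i : ℝ) * M.discounted (M.along (M.g i) a x) [] s ≤ F γ x s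
  upper : ∀ γ x s, F γ x s ≤ (1 + ∑ i, (γ i : ℝ)) * M.lipConst

end Model

end ForwardLooking

end

/-! Everything rests on one function, `dualInf`: the infimum, over multipliers that vanish after
finitely many periods, of the supremum of the Lagrangian over plans. It turns out to be the lottery
value, the dual value and the largest solution of the functional equation at once.

Recursion. A current multiplier `l` prices constraints on entire discounted streams of the `g i`.
Splitting each stream into its current term and its continuation moves the latter into next period's
weights, which become `γ + l` (`lagrangian_rec`). Multipliers may depend on the current action, so
choosing them before the action is the same as choosing one for each action afterwards; this turns
the inf-sup of the dual into the sup-inf of the equation (`solvesSupInf_dualInf`).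

Maximality. A solution `G` is unrolled against a multiplier of finite depth by inserting that
multiplier into the inner infimum. Once it has run out, `γ` stays put and ordinary discounted
dynamic programming finishes (`SolvesSupInf.le_dualSup`, `SolvesSupInf.le_dualSup_zero`). Finite
depth costs nothing in the dual, because the tail of a summable multiplier contributes little,
uniformly over plans (`dualValue_eq`).

Duality. Since actions are finite, admissible plans form a compact space on which these Lagrangians
are continuous. Weak duality follows by integrating the Lagrangian
(`integral_objective_le_dualSup`). For the converse, no function `L(·, μ) - dualInf` is negative
everywhere, and these functions form a convex set; Hahn-Banach and Riesz yield a probability measure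
under which all of them have nonnegative integral
(`exists_probabilityMeasure_forall_integral_nonneg`). Scaling up one multiplier extracts the
corresponding constraint, and the zero multiplier gives the value. Constraints are also imposed
after first shocks other than the given one, where the Lagrangian is blind; the convex set is
enlarged to cover them (`lagrangianPlusNonneg`). -/

noncomputable section
namespace ForwardLooking
namespace Model
variable {S A X : Type*} {I : ℕ}

/-! ### Conditional expectations and discounted sums -/

/-- A function of shock histories is bounded. -/
def IsBdd (f : List S → S → ℝ) : Prop := ∃ C : ℝ, ∀ past s, |f past s| ≤ C

theorem IsBdd.add {f h : List S → S → ℝ} (hf : IsBdd f) (hh : IsBdd h) :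
    IsBdd fun past s => f past s + h past s := by
  obtain ⟨C, hC⟩ := hf
  obtain ⟨D, hD⟩ := hh
  exact ⟨C + D, fun past s => (abs_add_le _ _).trans (add_le_add (hC _ _) (hD _ _))⟩

theorem IsBdd.const_mul {f : List S → S → ℝ} (c : ℝ) (hf : IsBdd f) :
    IsBdd fun past s => c * f past s := by
  obtain ⟨C, hC⟩ := hf
  exact ⟨|c| * C, fun past s => by
    rw [abs_mul]; exact mul_le_mul_of_nonneg_left (hC _ _) (abs_nonneg _)⟩

theorem IsBdd.mul {f h : List S → S → ℝ} (hf : IsBdd f) (hh : IsBdd h) :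
    IsBdd fun past s => f past s * h past s := by
  obtain ⟨C, hC⟩ := hf
  obtain ⟨D, hD⟩ := hh
  exact ⟨C * D, fun past s => by
    rw [abs_mul]
    exact mul_le_mul (hC _ _) (hD _ _) (abs_nonneg _) ((abs_nonneg _).trans (hC past s))⟩

theorem IsBdd.sum {ι : Type*} (t : Finset ι) {f : ι → List S → S → ℝ}
    (hf : ∀ i ∈ t, IsBdd (f i)) : IsBdd fun past s => ∑ i ∈ t, f i past s := by
  classical
  induction t using Finset.induction_on with
  | empty => exact ⟨0, by simp⟩
  | insert i t hi ih =>
    simp only [Finset.sum_insert hi]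
    exact (hf i (by simp)).add (ih fun j hj => hf j (by simp [hj]))

section Discounted

variable [Fintype S] {M : Model S A X I}

theorem expAfter_add (f h : List S → S → ℝ) (n : ℕ) (past : List S) (s : S) :
    M.expAfter (fun p t => f p t + h p t) n past s
      = M.expAfter f n past s + M.expAfter h n past s := by
  induction n generalizing past s with
  | zero => rfl
  | succ n ih => simp [expAfter, ih, mul_add, Finset.sum_add_distrib]

theorem expAfter_const_mul (c : ℝ) (f : List S → S → ℝ) (n : ℕ) (past : List S) (s : S) :
    M.expAfter (fun p t => c * f p t) n past s = c * M.expAfter f n past s := by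
  induction n generalizing past s with
  | zero => rfl
  | succ n ih => simp [expAfter, ih, mul_left_comm, Finset.mul_sum]

/-- Conditional expectations only look at histories with the same first shock. -/
theorem expAfter_congr {f h : List S → S → ℝ} {s₀ : S}
    (hfh : ∀ p t, p.getLastD t = s₀ → f p t = h p t) (n : ℕ) (past : List S) (s : S)
    (hs : past.getLastD s = s₀) : M.expAfter f n past s = M.expAfter h n past s := by
  induction n generalizing past s with
  | zero => exact hfh _ _ hs
  | succ n ih =>
    simp only [expAfter]
    exact Finset.sum_congr rfl fun t _ => by rw [ih (s :: past) t (by rwa [List.getLastD_cons])]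

theorem discounted_congr {f h : List S → S → ℝ} {s₀ : S}
    (hfh : ∀ p t, p.getLastD t = s₀ → f p t = h p t) (past : List S) (s : S)
    (hs : past.getLastD s = s₀) : M.discounted f past s = M.discounted h past s := by
  simp only [discounted]
  exact tsum_congr fun n => by rw [expAfter_congr hfh n past s hs]

/-- Histories are listed most recent first: the expectation conses new shocks at the head, while `++
[s₀]` inserts an earliest shock, so the two operations commute. -/
theorem expAfter_append (f : List S → S → ℝ) (s₀ : S) (n : ℕ) (past : List S) (s : S) :
    M.expAfter f n (past ++ [s₀]) s = M.expAfter (fun p t => f (p ++ [s₀]) t) n past s := by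
  induction n generalizing past s with
  | zero => rfl
  | succ n ih => simp [expAfter, ← ih]

theorem discounted_append (f : List S → S → ℝ) (s₀ : S) (past : List S) (s : S) :
    M.discounted f (past ++ [s₀]) s = M.discounted (fun p t => f (p ++ [s₀]) t) past s := by
  simp only [discounted, expAfter_append]

theorem expAfter_le (hM : M.Assumptions) {f h : List S → S → ℝ} (hfh : ∀ p t, f p t ≤ h p t)
    (n : ℕ) (past : List S) (s : S) : M.expAfter f n past s ≤ M.expAfter h n past s := by
  induction n generalizing past s with
  | zero => exact hfh _ _
  | succ n ih =>
    exact Finset.sum_le_sum fun t _ => mul_le_mul_of_nonneg_left (ih _ _) (hM.π_pos _ _).le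

theorem expAfter_const (hM : M.Assumptions) (C : ℝ) (n : ℕ) (past : List S) (s : S) :
    M.expAfter (fun _ _ => C) n past s = C := by
  induction n generalizing past s with
  | zero => rfl
  | succ n ih => simp [expAfter, ih, ← Finset.sum_mul, hM.π_sum]

theorem abs_expAfter_le (hM : M.Assumptions) {f : List S → S → ℝ} {C : ℝ}
    (hf : ∀ p t, |f p t| ≤ C) (n : ℕ) (past : List S) (s : S) :
    |M.expAfter f n past s| ≤ C := by
  rw [abs_le]
  constructor
  · rw [← expAfter_const hM (-C) n past s]
    exact expAfter_le hM (fun p t => (abs_le.1 (hf p t)).1) n past s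
  · rw [← expAfter_const hM C n past s]
    exact expAfter_le hM (fun p t => (abs_le.1 (hf p t)).2) n past s

theorem abs_discounted_term_le (hM : M.Assumptions) {f : List S → S → ℝ} {C : ℝ}
    (hf : ∀ p t, |f p t| ≤ C) (past : List S) (s : S) (n : ℕ) :
    ‖M.β ^ n * M.expAfter f n past s‖ ≤ M.β ^ n * C := by
  rw [Real.norm_eq_abs, abs_mul, abs_of_nonneg (pow_nonneg hM.β_pos.le n)]
  exact mul_le_mul_of_nonneg_left (abs_expAfter_le hM hf n past s) (pow_nonneg hM.β_pos.le n)

theorem hasSum_geometric_bound (hM : M.Assumptions) (C : ℝ) :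
    HasSum (fun n : ℕ => M.β ^ n * C) (C / (1 - M.β)) := by
  have := (hasSum_geometric_of_lt_one hM.β_pos.le hM.β_lt_one).mul_right C
  rwa [mul_comm, ← div_eq_mul_inv] at this

theorem summable_discounted (hM : M.Assumptions) {f : List S → S → ℝ} (hf : IsBdd f)
    (past : List S) (s : S) : Summable fun n : ℕ => M.β ^ n * M.expAfter f n past s := by
  obtain ⟨C, hC⟩ := hf
  exact Summable.of_norm_bounded (hasSum_geometric_bound hM C).summable
    (abs_discounted_term_le hM hC past s)

theorem abs_discounted_le (hM : M.Assumptions) {f : List S → S → ℝ} {C : ℝ}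
    (hf : ∀ p t, |f p t| ≤ C) (past : List S) (s : S) :
    |M.discounted f past s| ≤ C / (1 - M.β) :=
  tsum_of_norm_bounded (hasSum_geometric_bound hM C) (abs_discounted_term_le hM hf past s)

theorem IsBdd.discounted (hM : M.Assumptions) {f : List S → S → ℝ} (hf : IsBdd f) :
    IsBdd (M.discounted f) := by
  obtain ⟨C, hC⟩ := hf
  exact ⟨_, abs_discounted_le hM hC⟩

theorem discounted_add (hM : M.Assumptions) {f h : List S → S → ℝ} (hf : IsBdd f)
    (hh : IsBdd h) (past : List S) (s : S) :
    M.discounted (fun p t => f p t + h p t) past s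
      = M.discounted f past s + M.discounted h past s := by
  simp only [Model.discounted, expAfter_add, mul_add]
  exact (summable_discounted hM hf past s).tsum_add (summable_discounted hM hh past s)

theorem discounted_const_mul (c : ℝ) (f : List S → S → ℝ) (past : List S) (s : S) :
    M.discounted (fun p t => c * f p t) past s = c * M.discounted f past s := by
  simp only [Model.discounted, expAfter_const_mul, mul_left_comm _ c, tsum_mul_left]

theorem discounted_zero (past : List S) (s : S) :
    M.discounted (fun _ _ => 0) past s = 0 := by
  simpa using discounted_const_mul (M := M) 0 (fun _ _ => 0) past s

theorem discounted_sum (hM : M.Assumptions) {ι : Type*} (t : Finset ι)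
    {f : ι → List S → S → ℝ} (hf : ∀ i ∈ t, IsBdd (f i)) (past : List S) (s : S) :
    M.discounted (fun p u => ∑ i ∈ t, f i p u) past s
      = ∑ i ∈ t, M.discounted (f i) past s := by
  classical
  induction t using Finset.induction_on with
  | empty => simp [discounted_zero]
  | insert i t hi ih =>
    simp only [Finset.sum_insert hi]
    rw [discounted_add hM (hf i (by simp)) (IsBdd.sum t fun j hj => hf j (by simp [hj])),
      ih fun j hj => hf j (by simp [hj])]

/-- The recursion satisfied by discounted expected sums. -/
theorem discounted_eq (hM : M.Assumptions) {f : List S → S → ℝ} (hf : IsBdd f)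
    (past : List S) (s : S) :
    M.discounted f past s
      = f past s + M.β * ∑ s', M.π s s' * M.discounted f (s :: past) s' := by
  rw [Model.discounted, (summable_discounted hM hf past s).tsum_eq_zero_add]
  congr 1
  · simp [expAfter]
  · simp only [expAfter, Model.discounted, ← tsum_mul_left]
    rw [← Summable.tsum_finsetSum fun t _ =>
      (summable_discounted hM hf (s :: past) t).mul_left _, ← tsum_mul_left]
    refine tsum_congr fun n => ?_
    simp only [Finset.mul_sum]
    exact Finset.sum_congr rfl fun t _ => by ring

end Discounted

/-! ### Cutting and pasting plans -/

/-- The plan that remains after the first shock `s₀`. -/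
def shiftPlan (a : Plan S A) (s₀ : S) : Plan S A := fun past s => a (past ++ [s₀]) s

/-- The plan that takes the actions `b` in the first period and continues with `a s`, where `s` is
the first shock. -/
def consPlan (b : S → A) (a : S → Plan S A) : Plan S A
  | [], s => b s
  -- The earliest shock is the last entry of `s' :: past`, which is the default `s'` when `past` is
  -- empty; `dropLast` removes it from the history handed to the continuation.
  | s' :: past, s => a (past.getLastD s') (s' :: past).dropLast s

/-- The multipliers that remain after the first shock and action `z`. -/
def shiftMultiplier (μ : Multiplier S A I) (z : S × A) : Multiplier S A I :=
  fun past s b => μ (past ++ [z]) s b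

/-- The multipliers that start with `l` and continue with `μ z`, where `z` is the pair of
the first shock and the first action. -/
def consMultiplier (l : S → A → Fin I → ℝ≥0) (μ : S × A → Multiplier S A I) : Multiplier S A I
  | [], s, b => l s b
  | z :: past, s, b => μ (past.getLastD z) (z :: past).dropLast s b

/-- The plan that follows `a s`, where `s` is the first shock. -/
def gluePlan (a : S → Plan S A) : Plan S A := fun past s => a (past.getLastD s) past s

/-- The multipliers that follow `μ s`, where `s` is the first shock. -/
def glueMultiplier (μ : S → Multiplier S A I) : Multiplier S A I :=
  fun past s b => μ ((past.map Prod.fst).getLastD s) past s b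

@[simp] theorem consPlan_nil (b : S → A) (a : S → Plan S A) (s : S) :
    consPlan b a [] s = b s := rfl

theorem shiftPlan_consPlan (b : S → A) (a : S → Plan S A) (s : S) :
    shiftPlan (consPlan b a) s = a s := by
  funext past t
  cases past with
  | nil => rfl
  | cons q past => simp [shiftPlan, consPlan, List.dropLast]

theorem shiftMultiplier_consMultiplier (l : S → A → Fin I → ℝ≥0)
    (μ : S × A → Multiplier S A I) (z : S × A) :
    shiftMultiplier (consMultiplier l μ) z = μ z := by
  funext past t b
  cases past with
  | nil => rfl
  | cons q past => simp [shiftMultiplier, consMultiplier, List.dropLast]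

theorem realized_map_fst (a : Plan S A) (past : List S) :
    (realized a past).map Prod.fst = past := by
  induction past with
  | nil => rfl
  | cons s past ih => simp [realized, ih]

theorem length_realized (a : Plan S A) (past : List S) :
    (realized a past).length = past.length := by
  conv_rhs => rw [← realized_map_fst a past, List.length_map]

theorem realized_append (a : Plan S A) (s₀ : S) (past : List S) :
    realized a (past ++ [s₀]) = realized (shiftPlan a s₀) past ++ [(s₀, a [] s₀)] := by
  induction past with
  | nil => rfl
  | cons s past ih => simp [realized, ih, shiftPlan]

theorem realized_congr {a a' : Plan S A} {s₀ : S}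
    (h : ∀ p t, p.getLastD t = s₀ → a p t = a' p t) (past : List S) (s : S)
    (hs : past.getLastD s = s₀) : realized a past = realized a' past := by
  induction past generalizing s with
  | nil => rfl
  | cons q past ih =>
    rw [List.getLastD_cons] at hs
    simp only [realized, ih q hs, h past q hs]

section Plans

variable {M : Model S A X I}

theorem state_append (a : Plan S A) (x : X) (s₀ : S) (past : List S) :
    M.state a x (past ++ [s₀]) = M.state (shiftPlan a s₀) (M.ζ x (a [] s₀) s₀) past := by
  induction past with
  | nil => rfl
  | cons s past ih => simp [state, ih, shiftPlan]

theorem state_congr {a a' : Plan S A} {s₀ : S}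
    (h : ∀ p t, p.getLastD t = s₀ → a p t = a' p t) (x : X) (past : List S) (s : S)
    (hs : past.getLastD s = s₀) : M.state a x past = M.state a' x past := by
  induction past generalizing s with
  | nil => rfl
  | cons q past ih =>
    rw [List.getLastD_cons] at hs
    simp only [state, ih q hs, h past q hs]

theorem along_congr {a a' : Plan S A} {s₀ : S}
    (h : ∀ p t, p.getLastD t = s₀ → a p t = a' p t) (f : X → A → S → ℝ) (x : X)
    (past : List S) (s : S) (hs : past.getLastD s = s₀) :
    M.along f a x past s = M.along f a' x past s := by
  simp only [along, state_congr h x past s hs, h past s hs]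

theorem along_append (f : X → A → S → ℝ) (a : Plan S A) (x : X) (s₀ : S) (past : List S)
    (s : S) : M.along f a x (past ++ [s₀]) s
      = M.along f (shiftPlan a s₀) (M.ζ x (a [] s₀) s₀) past s := by
  simp [along, state_append, shiftPlan]

theorem along_isBdd {f : X → A → S → ℝ} (hf : ∃ C : ℝ, ∀ x a s, |f x a s| ≤ C)
    (a : Plan S A) (x : X) : IsBdd (M.along f a x) := by
  obtain ⟨C, hC⟩ := hf
  exact ⟨C, fun _ _ => hC _ _ _⟩

theorem shiftPlan_admissible {a : Plan S A} {x : X} (ha : a ∈ M.admissible x) (s : S) :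
    shiftPlan a s ∈ M.admissible (M.ζ x (a [] s) s) := fun past t => by
  have := ha (past ++ [s]) t
  rwa [state_append] at this

theorem consPlan_admissible {b : S → A} {a : S → Plan S A} {x : X}
    (hb : ∀ s, b s ∈ M.allowed x s) (ha : ∀ s, a s ∈ M.admissible (M.ζ x (b s) s)) :
    consPlan b a ∈ M.admissible x := fun past t => by
  rcases List.eq_nil_or_concat past with rfl | ⟨past, s, rfl⟩
  · exact hb t
  · have h := ha s past t
    rw [← shiftPlan_consPlan b a s] at h
    rw [List.concat_eq_append, state_append]
    exact h

theorem gluePlan_eq (a : S → Plan S A) (s₀ : S) (p : List S) (t : S)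
    (h : p.getLastD t = s₀) : gluePlan a p t = a s₀ p t := by
  simp only [gluePlan, h]

theorem gluePlan_admissible {a : S → Plan S A} {x : X} (ha : ∀ s, a s ∈ M.admissible x) :
    gluePlan a ∈ M.admissible x := fun past t => by
  rw [state_congr (gluePlan_eq a (past.getLastD t)) x past t rfl]
  exact ha _ past t

/-- Multipliers are bounded. -/
def BddMultiplier (μ : Multiplier S A I) : Prop := ∃ C : ℝ, ∀ p s b i, (μ p s b i : ℝ) ≤ C

theorem BddMultiplier.shift {μ : Multiplier S A I} (hμ : BddMultiplier μ) (z : S × A) :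
    BddMultiplier (shiftMultiplier μ z) := by
  obtain ⟨C, hC⟩ := hμ
  exact ⟨C, fun p s b i => hC _ _ _ _⟩

section

variable [Fintype S]

theorem slack_congr {a a' : Plan S A} {s₀ : S}
    (h : ∀ p t, p.getLastD t = s₀ → a p t = a' p t) (i : Fin I) (x : X)
    (past : List S) (s : S) (hs : past.getLastD s = s₀) :
    M.slack i a x past s = M.slack i a' x past s := by
  simp only [slack, along_congr h _ x past s hs]
  rw [discounted_congr (fun p t hp => along_congr h _ x p t hp) past s hs]

theorem slack_append (i : Fin I) (a : Plan S A) (x : X) (s₀ : S) (past : List S) (s : S) :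
    M.slack i a x (past ++ [s₀]) s
      = M.slack i (shiftPlan a s₀) (M.ζ x (a [] s₀) s₀) past s := by
  simp only [slack, along_append, discounted_append]

theorem slack_isBdd (hM : M.Assumptions) (i : Fin I) (a : Plan S A) (x : X) :
    IsBdd (M.slack i a x) := by
  have h := ((along_isBdd (M := M) (hM.g_bdd i) a x).discounted hM).add
    ((along_isBdd (M := M) (hM.gbar_bdd i) a x).const_mul (-1))
  simp only [neg_one_mul, ← sub_eq_add_neg] at h
  exact h

theorem payoff_bdd (hM : M.Assumptions) (γ : Fin I → ℝ≥0) :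
    ∃ C : ℝ, ∀ x a s, |M.payoff γ x a s| ≤ C := by
  obtain ⟨C, hC⟩ := hM.r_bdd
  choose D hD using hM.g_bdd
  refine ⟨C + ∑ i, (γ i : ℝ) * D i, fun x a s => (abs_add_le _ _).trans
    (add_le_add (hC _ _ _) ((Finset.abs_sum_le_sum_abs _ _).trans
      (Finset.sum_le_sum fun i _ => ?_)))⟩
  rw [abs_mul, abs_of_nonneg (γ i).coe_nonneg]
  exact mul_le_mul_of_nonneg_left (hD i _ _ _) (γ i).coe_nonneg

/-- A uniform bound on the slack. -/
theorem exists_abs_slack_le (hM : M.Assumptions) :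
    ∃ C : ℝ, 0 ≤ C ∧ ∀ i a x past s, |M.slack i a x past s| ≤ C := by
  choose C hC using hM.g_bdd
  choose D hD using hM.gbar_bdd
  have key : ∀ i a x past s, |M.slack i a x past s| ≤ |C i / (1 - M.β) + D i| := by
    intro i a x past s
    refine le_trans ?_ (le_abs_self _)
    exact (abs_sub _ _).trans (add_le_add
      (abs_discounted_le hM (fun p t => hC i _ _ _) past s) (hD i _ _ _))
  refine ⟨∑ i, |C i / (1 - M.β) + D i|, Finset.sum_nonneg fun i _ => abs_nonneg _,
    fun i a x past s => (key i a x past s).trans ?_⟩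
  exact Finset.single_le_sum (f := fun i => |C i / (1 - M.β) + D i|)
    (fun j _ => abs_nonneg _) (Finset.mem_univ i)

/-! ### The Lagrangian -/

/-- The part of the Lagrangian that involves the multipliers, before discounting. -/
def penalty (M : Model S A X I) (a : Plan S A) (x : X) (μ : Multiplier S A I) :
    List S → S → ℝ :=
  fun past s => ∑ i, (μ (realized a past) s (a past s) i : ℝ) * M.slack i a x past s

theorem penalty_isBdd (hM : M.Assumptions) (a : Plan S A) (x : X) {μ : Multiplier S A I}
    (hμ : BddMultiplier μ) : IsBdd (M.penalty a x μ) := by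
  obtain ⟨C, hC⟩ := hμ
  refine IsBdd.sum _ fun i _ => IsBdd.mul ⟨C, fun p t => ?_⟩ (slack_isBdd hM i a x)
  rw [abs_of_nonneg (NNReal.coe_nonneg _)]
  exact hC _ _ _ _

theorem lagrangian_eq (hM : M.Assumptions) (γ : Fin I → ℝ≥0) (x : X) (s : S) (a : Plan S A)
    {μ : Multiplier S A I} (hμ : BddMultiplier μ) :
    M.lagrangian γ x s a μ = M.objective γ x s a + M.discounted (M.penalty a x μ) [] s :=
  discounted_add hM (along_isBdd (payoff_bdd hM γ) a x) (penalty_isBdd hM a x hμ) [] s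

theorem objective_eq (hM : M.Assumptions) (γ : Fin I → ℝ≥0) (x : X) (s : S) (a : Plan S A) :
    M.objective γ x s a = M.discounted (M.along M.r a x) [] s
      + ∑ i, (γ i : ℝ) * M.discounted (M.along (M.g i) a x) [] s := by
  simp only [← discounted_const_mul]
  have hb : ∀ i ∈ Finset.univ, IsBdd fun p t => (γ i : ℝ) * M.along (M.g i) a x p t :=
    fun i _ => (along_isBdd (hM.g_bdd i) a x).const_mul _
  rw [← discounted_sum hM _ hb, ← discounted_add hM (along_isBdd hM.r_bdd a x)
    (IsBdd.sum _ hb)]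
  rfl

/-- The Lagrangian is unchanged if the plan and the multipliers change only after other first
shocks. -/
theorem lagrangian_congr {a a' : Plan S A} {μ μ' : Multiplier S A I} {s : S}
    (h : ∀ p t, p.getLastD t = s → a p t = a' p t)
    (hμ : ∀ p t b, (p.map Prod.fst).getLastD t = s → μ p t b = μ' p t b)
    (γ : Fin I → ℝ≥0) (x : X) :
    M.lagrangian γ x s a μ = M.lagrangian γ x s a' μ' := by
  refine discounted_congr (s₀ := s) (fun p t hp => ?_) [] s rfl
  simp only [along_congr h _ x p t hp, slack_congr h _ x p t hp, h p t hp,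
    realized_congr h p t hp]
  rw [hμ _ _ _ (by rwa [realized_map_fst])]

/-- The recursive form of the Lagrangian. -/
theorem lagrangian_rec (hM : M.Assumptions) (γ : Fin I → ℝ≥0) (x : X) (s : S) (a : Plan S A)
    {μ : Multiplier S A I} (hμ : BddMultiplier μ) :
    M.lagrangian γ x s a μ = M.r x (a [] s) s
      + ∑ i, ((γ i : ℝ) * M.g i x (a [] s) s
        + (μ [] s (a [] s) i : ℝ) * (M.g i x (a [] s) s - M.gbar i x (a [] s) s))
      + M.β * ∑ s', M.π s s' * M.lagrangian (γ + μ [] s (a [] s)) (M.ζ x (a [] s) s) s'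
          (shiftPlan a s) (shiftMultiplier μ (s, a [] s)) := by
  set b := a [] s with hb
  set x' := M.ζ x b s with hx'
  set a' := shiftPlan a s
  have hsh := hμ.shift (s, b)
  -- Raising the weights from `γ` to `γ + μ [] s b` adds exactly the discounted continuation streams
  -- of the `g i`, weighted by the current multiplier.
  have hcont : ∀ s', M.lagrangian (γ + μ [] s b) x' s' a' (shiftMultiplier μ (s, b))
      = M.discounted (fun past s => M.along (M.payoff γ) a x past s
          + M.penalty a x μ past s) [s] s'
        + ∑ i, (μ [] s b i : ℝ) * M.discounted (M.along (M.g i) a x) [s] s' := by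
    intro s'
    have hg : ∀ i ∈ Finset.univ, IsBdd fun p t => (μ [] s b i : ℝ) * M.along (M.g i) a' x' p t :=
      fun i _ => (along_isBdd (hM.g_bdd i) a' x').const_mul _
    rw [show [s] = [] ++ [s] from rfl]
    simp only [discounted_append, ← discounted_const_mul]
    simp only [along_append, ← hb, ← hx']
    rw [← discounted_sum hM _ hg, ← discounted_add hM _ (IsBdd.sum _ hg)]
    · refine discounted_congr (s₀ := s') (fun p t _ => ?_) [] s' rfl
      simp only [penalty, along, payoff, Pi.add_apply, NNReal.coe_add, add_mul,
        Finset.sum_add_distrib, realized_append, slack_append, shiftMultiplier, ← hb, ← hx']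
      simp only [a', shiftPlan]
      ring
    · have := (along_isBdd (M := M) (payoff_bdd hM γ) a' x').add (penalty_isBdd hM a' x' hsh)
      refine this.imp fun C hC p t => ?_
      refine le_trans (le_of_eq ?_) (hC p t)
      simp only [penalty, realized_append, slack_append, shiftMultiplier, ← hb, ← hx']
      rfl
  simp only [hcont]
  have hL : IsBdd fun past s => M.along (M.payoff γ) a x past s + M.penalty a x μ past s :=
    (along_isBdd (payoff_bdd hM γ) a x).add (penalty_isBdd hM a x hμ)
  rw [lagrangian]
  refine (discounted_eq hM hL [] s).trans ?_
  change M.along (M.payoff γ) a x [] s + ∑ i, (μ [] s b i : ℝ) * M.slack i a x [] s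
    + M.β * ∑ s', M.π s s' * M.discounted (fun past s => M.along (M.payoff γ) a x past s
          + M.penalty a x μ past s) [s] s' = _
  -- The current slack is a one-period term plus a discounted continuation; weighted by the
  -- multiplier, the latter matches the extra sum in `hcont`.
  have hsl : ∀ i, M.slack i a x [] s = M.g i x b s - M.gbar i x b s
      + M.β * ∑ s', M.π s s' * M.discounted (M.along (M.g i) a x) [s] s' := by
    intro i
    rw [slack, discounted_eq hM (along_isBdd (hM.g_bdd i) a x)]
    simp only [along, state, ← hb]
    ring
  have hsw : ∑ s', M.π s s' * ∑ i, (μ [] s b i : ℝ) * M.discounted (M.along (M.g i) a x) [s] s'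
      = ∑ i, (μ [] s b i : ℝ) * ∑ s', M.π s s' * M.discounted (M.along (M.g i) a x) [s] s' := by
    simp only [Finset.mul_sum]
    rw [Finset.sum_comm]
    exact Finset.sum_congr rfl fun i _ => Finset.sum_congr rfl fun t _ => by ring
  have hsm : ∀ Y : Fin I → ℝ, ∑ i, (μ [] s b i : ℝ)
      * (M.g i x b s - M.gbar i x b s + M.β * Y i)
      = ∑ i, (μ [] s b i : ℝ) * (M.g i x b s - M.gbar i x b s)
        + M.β * ∑ i, (μ [] s b i : ℝ) * Y i := by
    intro Y
    rw [Finset.mul_sum, ← Finset.sum_add_distrib]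
    exact Finset.sum_congr rfl fun i _ => by ring
  simp only [hsl, hsm]
  simp only [mul_add (M.π s _), Finset.sum_add_distrib, hsw]
  simp only [along, payoff, state, ← hb]
  ring

end

end Plans

/-! ### The dual problem with multipliers of finite depth -/

/-- The multipliers that vanish after finitely many periods. -/
def FiniteDepth (μ : Multiplier S A I) : Prop :=
  ∃ T : ℕ, ∀ p s b, T ≤ p.length → μ p s b = 0

theorem finiteDepth_zero : FiniteDepth (0 : Multiplier S A I) := ⟨0, fun _ _ _ _ => rfl⟩

theorem FiniteDepth.shift {μ : Multiplier S A I} (hμ : FiniteDepth μ) (z : S × A) :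
    FiniteDepth (shiftMultiplier μ z) := by
  obtain ⟨T, hT⟩ := hμ
  exact ⟨T, fun p s b hp => hT _ _ _ (by simp; omega)⟩

theorem FiniteDepth.glue [Finite S] {μ : S → Multiplier S A I} (hμ : ∀ s, FiniteDepth (μ s)) :
    FiniteDepth (glueMultiplier μ) := by
  choose T hT using hμ
  obtain ⟨N, hN⟩ := Finite.exists_le T
  exact ⟨N, fun p s b hp => hT _ _ _ _ ((hN _).trans hp)⟩

theorem FiniteDepth.cons [Finite S] [Finite A] (l : S → A → Fin I → ℝ≥0)
    {μ : S × A → Multiplier S A I} (hμ : ∀ z, FiniteDepth (μ z)) :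
    FiniteDepth (consMultiplier l μ) := by
  choose T hT using hμ
  obtain ⟨N, hN⟩ := Finite.exists_le T
  refine ⟨N + 1, fun p s b hp => ?_⟩
  cases p with
  | nil => simp at hp
  | cons z p => exact hT _ _ _ _ ((hN _).trans (by simp at hp ⊢; omega))

theorem FiniteDepth.finite_support [Finite S] [Finite A] {μ : Multiplier S A I}
    (hμ : FiniteDepth μ) :
    {h : List (S × A) × S × A × Fin I | μ h.1 h.2.1 h.2.2.1 h.2.2.2 ≠ 0}.Finite := by
  obtain ⟨T, hT⟩ := hμ
  refine ((List.finite_length_lt (S × A) T).prod (Set.finite_univ (α := S × A × Fin I))).subset ?_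
  rintro ⟨p, s, b, i⟩ h
  refine ⟨?_, Set.mem_univ _⟩
  by_contra hp
  exact h (congrFun (hT p s b (not_lt.1 hp)) i)

theorem FiniteDepth.bdd [Finite S] [Finite A] {μ : Multiplier S A I} (hμ : FiniteDepth μ) :
    BddMultiplier μ := by
  have hfin := hμ.finite_support
  obtain ⟨C, hC⟩ := (hfin.image
    fun h : List (S × A) × S × A × Fin I => (μ h.1 h.2.1 h.2.2.1 h.2.2.2 : ℝ)).bddAbove
  refine ⟨max C 0, fun p s b i => ?_⟩
  by_cases h : μ p s b i = 0
  · simp [h]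
  · exact (hC ⟨(p, s, b, i), h, rfl⟩).trans (le_max_left _ _)

section Dual

variable [Fintype S] {M : Model S A X I}

/-- The right-hand side of the functional equation for a given action `b` and multiplier `l`. -/
def stage (M : Model S A X I) (F : (Fin I → ℝ≥0) → X → S → ℝ) (γ : Fin I → ℝ≥0) (x : X) (s : S)
    (b : A) (l : Fin I → ℝ≥0) : ℝ :=
  M.r x b s + ∑ i, ((γ i : ℝ) * M.g i x b s + (l i : ℝ) * (M.g i x b s - M.gbar i x b s))
    + M.β * ∑ s', M.π s s' * F (γ + l) (M.ζ x b s) s'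

/-- The continuation enters with weight `β` and probabilities sum to one, so an error `ε` in it
shrinks to `β * ε`. -/
theorem stage_le_add (hM : M.Assumptions) {F G : (Fin I → ℝ≥0) → X → S → ℝ}
    {γ : Fin I → ℝ≥0} {x : X} {s : S} {b : A} {l : Fin I → ℝ≥0} {ε : ℝ}
    (h : ∀ s', F (γ + l) (M.ζ x b s) s' ≤ G (γ + l) (M.ζ x b s) s' + ε) :
    M.stage F γ x s b l ≤ M.stage G γ x s b l + M.β * ε := by
  have : ∑ s', M.π s s' * F (γ + l) (M.ζ x b s) s'
      ≤ ∑ s', M.π s s' * G (γ + l) (M.ζ x b s) s' + ε := by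
    calc _ ≤ ∑ s', M.π s s' * (G (γ + l) (M.ζ x b s) s' + ε) :=
          Finset.sum_le_sum fun s' _ => mul_le_mul_of_nonneg_left (h s') (hM.π_pos _ _).le
      _ = _ := by simp only [mul_add, Finset.sum_add_distrib, ← Finset.sum_mul, hM.π_sum, one_mul]
  have := mul_le_mul_of_nonneg_left this hM.β_pos.le
  simp only [stage]
  linarith

theorem stage_mono (hM : M.Assumptions) {F G : (Fin I → ℝ≥0) → X → S → ℝ}
    {γ : Fin I → ℝ≥0} {x : X} {s : S} {b : A} {l : Fin I → ℝ≥0}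
    (h : ∀ s', F (γ + l) (M.ζ x b s) s' ≤ G (γ + l) (M.ζ x b s) s') :
    M.stage F γ x s b l ≤ M.stage G γ x s b l := by
  simpa using stage_le_add hM (ε := 0) (by simpa using h)

theorem exists_abs_penalty_le (hM : M.Assumptions) {μ : Multiplier S A I}
    (hμ : BddMultiplier μ) : ∃ K : ℝ, ∀ a x p s, |M.penalty a x μ p s| ≤ K := by
  obtain ⟨D, hD0, hD⟩ := exists_abs_slack_le hM
  obtain ⟨E, hE⟩ := hμ
  refine ⟨∑ _i : Fin I, E * D, fun a x p t =>
    (Finset.abs_sum_le_sum_abs _ _).trans (Finset.sum_le_sum fun i _ => ?_)⟩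
  rw [abs_mul, abs_of_nonneg (NNReal.coe_nonneg _)]
  exact mul_le_mul (hE _ _ _ _) (hD _ _ _ _ _) (abs_nonneg _)
    ((NNReal.coe_nonneg _).trans (hE (realized a p) t (a p t) i))

theorem exists_abs_lagrangian_le (hM : M.Assumptions) (γ : Fin I → ℝ≥0) {μ : Multiplier S A I}
    (hμ : BddMultiplier μ) : ∃ K : ℝ, ∀ x s a, |M.lagrangian γ x s a μ| ≤ K := by
  obtain ⟨C, hC⟩ := payoff_bdd hM γ
  obtain ⟨K, hK⟩ := exists_abs_penalty_le hM hμ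
  exact ⟨(C + K) / (1 - M.β), fun x s a => abs_discounted_le hM
    (fun p t => (abs_add_le _ _).trans (add_le_add (hC _ _ _) (hK a x p t))) [] s⟩

/-- The supremum of the Lagrangian over admissible plans. -/
def dualSup (M : Model S A X I) (γ : Fin I → ℝ≥0) (x : X) (s : S) (μ : Multiplier S A I) : ℝ :=
  ⨆ a : M.admissible x, M.lagrangian γ x s a μ

theorem admissible_nonempty (hM : M.Assumptions) (x : X) : Nonempty (M.admissible x) := by
  obtain ⟨a, ha⟩ := hM.feasible x
  exact ⟨⟨a, ha.1⟩⟩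

theorem lagrangian_le_dualSup (hM : M.Assumptions) (γ : Fin I → ℝ≥0) {x : X} (s : S)
    {μ : Multiplier S A I} (hμ : BddMultiplier μ) {a : Plan S A} (ha : a ∈ M.admissible x) :
    M.lagrangian γ x s a μ ≤ M.dualSup γ x s μ := by
  obtain ⟨K, hK⟩ := exists_abs_lagrangian_le hM γ hμ
  refine le_ciSup (f := fun a : M.admissible x => M.lagrangian γ x s a μ) ⟨K, ?_⟩ ⟨a, ha⟩
  rintro _ ⟨a, rfl⟩
  exact (le_abs_self _).trans (hK _ _ _)

theorem exists_dualSup_lt (hM : M.Assumptions) (γ : Fin I → ℝ≥0) (x : X) (s : S)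
    (μ : Multiplier S A I) {ε : ℝ} (hε : 0 < ε) :
    ∃ a ∈ M.admissible x, M.dualSup γ x s μ < M.lagrangian γ x s a μ + ε := by
  have := admissible_nonempty hM x
  obtain ⟨a, ha⟩ := exists_lt_of_lt_ciSup (show M.dualSup γ x s μ - ε < M.dualSup γ x s μ by linarith)
  exact ⟨a, a.2, by linarith⟩

/-- Pasting continuation plans. -/
theorem stage_le_dualSup (hM : M.Assumptions) (γ : Fin I → ℝ≥0) {x : X} {s : S}
    {μ : Multiplier S A I} (hμ : BddMultiplier μ) {b : A} (hb : b ∈ M.allowed x s) :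
    M.stage (fun γ x s' => M.dualSup γ x s' (shiftMultiplier μ (s, b))) γ x s b (μ [] s b)
      ≤ M.dualSup γ x s μ := by
  classical
  refine le_of_forall_pos_le_add fun ε hε => ?_
  choose a ha hlt using fun s' => exists_dualSup_lt hM (γ + μ [] s b) (M.ζ x b s) s'
    (shiftMultiplier μ (s, b)) hε
  obtain ⟨f, hf, -⟩ := hM.feasible x
  -- After the first shock `s`, take `b` and then nearly optimal continuations. After other first
  -- shocks, follow the feasible plan `f`, since admissibility is required of the entire plan.
  set c : Plan S A := consPlan (Function.update (f []) s b)
    (Function.update (shiftPlan f) s (gluePlan a)) with hc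
  have hcs : c [] s = b := by simp [hc]
  have hsh : shiftPlan c s = gluePlan a := by simp [hc, shiftPlan_consPlan]
  have hcadm : c ∈ M.admissible x := by
    refine consPlan_admissible (fun t => ?_) fun t => ?_ <;> rcases eq_or_ne t s with rfl | ht
    · simpa using hb
    · simpa [ht, state] using hf [] t
    · simpa using gluePlan_admissible ha
    · simpa [ht] using shiftPlan_admissible hf t
  have h := lagrangian_le_dualSup hM γ s hμ hcadm
  rw [lagrangian_rec hM γ x s c hμ, hcs, hsh] at h
  change M.stage (fun γ x s' => M.lagrangian γ x s' (gluePlan a) (shiftMultiplier μ (s, b)))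
    γ x s b (μ [] s b) ≤ _ at h
  have h2 := stage_le_add (ε := ε) hM (γ := γ) (x := x) (s := s) (b := b) (l := μ [] s b)
    (F := fun γ x s' => M.dualSup γ x s' (shiftMultiplier μ (s, b)))
    (G := fun γ x s' => M.lagrangian γ x s' (gluePlan a) (shiftMultiplier μ (s, b)))
    fun s' => by
      rw [lagrangian_congr (gluePlan_eq a s') (fun _ _ _ _ => rfl)]
      exact (hlt s').le
  have := mul_le_of_le_one_left hε.le hM.β_lt_one.le
  linarith

/-- Cutting plans after the first period. -/
theorem dualSup_le (hM : M.Assumptions) {γ : Fin I → ℝ≥0} {x : X} {s : S}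
    {μ : Multiplier S A I} (hμ : BddMultiplier μ) {v : ℝ}
    (h : ∀ b ∈ M.allowed x s, M.stage (fun γ x s' => M.dualSup γ x s' (shiftMultiplier μ (s, b)))
      γ x s b (μ [] s b) ≤ v) : M.dualSup γ x s μ ≤ v := by
  have := admissible_nonempty hM x
  refine ciSup_le fun a => ?_
  rw [lagrangian_rec hM γ x s a hμ]
  refine le_trans ?_ (h _ (a.2 [] s))
  exact stage_mono hM (F := fun γ x s' => M.lagrangian γ x s' (shiftPlan a s)
    (shiftMultiplier μ (s, a.1 [] s))) fun s' =>
    lagrangian_le_dualSup hM _ s' (hμ.shift _) (shiftPlan_admissible a.2 s)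

theorem dualSup_congr {γ : Fin I → ℝ≥0} {x : X} {s : S} {μ μ' : Multiplier S A I}
    (hμ : ∀ p t b, (p.map Prod.fst).getLastD t = s → μ p t b = μ' p t b) :
    M.dualSup γ x s μ = M.dualSup γ x s μ' :=
  iSup_congr fun _ => lagrangian_congr (fun _ _ _ => rfl) hμ γ x

/-- The value of the dual problem with multipliers of finite depth. -/
def dualInf (M : Model S A X I) (γ : Fin I → ℝ≥0) (x : X) (s : S) : ℝ :=
  ⨅ μ : {μ : Multiplier S A I // FiniteDepth μ}, M.dualSup γ x s μ

theorem penalty_nonneg {x : X} {a : Plan S A} (ha : M.Feasible x a) (μ : Multiplier S A I)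
    (past : List S) (s : S) : 0 ≤ M.penalty a x μ past s :=
  Finset.sum_nonneg fun i _ => mul_nonneg (NNReal.coe_nonneg _) (ha.2 i past s)

theorem discounted_nonneg (hM : M.Assumptions) {f : List S → S → ℝ} (hf : ∀ p t, 0 ≤ f p t)
    (past : List S) (s : S) : 0 ≤ M.discounted f past s :=
  tsum_nonneg fun n => mul_nonneg (pow_nonneg hM.β_pos.le n) <| by
    rw [← expAfter_const hM 0 n past s]
    exact expAfter_le hM hf n past s

/-- At a feasible plan every penalty term is nonnegative. This bounds the dual from below. -/
theorem objective_le_lagrangian (hM : M.Assumptions) (γ : Fin I → ℝ≥0) {x : X} (s : S)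
    {μ : Multiplier S A I} (hμ : BddMultiplier μ) {a : Plan S A} (ha : M.Feasible x a) :
    M.objective γ x s a ≤ M.lagrangian γ x s a μ := by
  rw [lagrangian_eq hM γ x s a hμ]
  exact le_add_of_nonneg_right (discounted_nonneg hM (penalty_nonneg ha μ) [] s)

theorem exists_lt_of_dualInf_lt {γ : Fin I → ℝ≥0} {x : X} {s : S} {v : ℝ}
    (h : M.dualInf γ x s < v) : ∃ μ : Multiplier S A I, FiniteDepth μ ∧ M.dualSup γ x s μ < v := by
  have : Nonempty {μ : Multiplier S A I // FiniteDepth μ} := ⟨⟨0, finiteDepth_zero⟩⟩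
  obtain ⟨μ, hμ⟩ := exists_lt_of_ciInf_lt h
  exact ⟨μ, μ.2, hμ⟩

theorem le_dualInf {γ : Fin I → ℝ≥0} {x : X} {s : S} {v : ℝ}
    (h : ∀ μ : Multiplier S A I, FiniteDepth μ → v ≤ M.dualSup γ x s μ) :
    v ≤ M.dualInf γ x s := by
  have : Nonempty {μ : Multiplier S A I // FiniteDepth μ} := ⟨⟨0, finiteDepth_zero⟩⟩
  exact le_ciInf fun μ => h μ μ.2

variable [Finite A]

/-- A feasible plan bounds all the suprema from below by its objective, so the real-valued infimum
is a genuine one. -/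
theorem dualInf_le (hM : M.Assumptions) (γ : Fin I → ℝ≥0) (x : X) (s : S) {μ : Multiplier S A I}
    (hμ : FiniteDepth μ) : M.dualInf γ x s ≤ M.dualSup γ x s μ := by
  obtain ⟨a, ha⟩ := hM.feasible x
  refine ciInf_le (f := fun μ : {μ : Multiplier S A I // FiniteDepth μ} => M.dualSup γ x s μ)
    ⟨M.objective γ x s a, ?_⟩ ⟨μ, hμ⟩
  rintro _ ⟨ν, rfl⟩
  exact (objective_le_lagrangian hM γ s ν.2.bdd ha).trans
    (lagrangian_le_dualSup hM γ s ν.2.bdd ha.1)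

/-- Pasting multipliers. -/
theorem dualInf_le_of_stage_le (hM : M.Assumptions) {γ : Fin I → ℝ≥0} {x : X} {s : S}
    {l : A → Fin I → ℝ≥0} {v : ℝ}
    (h : ∀ b ∈ M.allowed x s, M.stage M.dualInf γ x s b (l b) ≤ v) : M.dualInf γ x s ≤ v := by
  refine le_of_forall_pos_le_add fun ε hε => ?_
  choose μ hμ hlt using fun b s' => exists_lt_of_dualInf_lt
    (show M.dualInf (γ + l b) (M.ζ x b s) s' < M.dualInf (γ + l b) (M.ζ x b s) s' + ε by linarith)
  -- Continuation multipliers are chosen separately for each current action and next shock. There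
  -- are finitely many such pairs, so the pasted multiplier still has finite depth.
  set ν : Multiplier S A I := consMultiplier (fun _ b => l b) fun z => glueMultiplier (μ z.2)
  have hν : FiniteDepth ν := FiniteDepth.cons _ fun z => FiniteDepth.glue (hμ z.2)
  refine (dualInf_le hM γ x s hν).trans (dualSup_le hM hν.bdd fun b hb => ?_)
  have h2 := stage_le_add (ε := ε) hM (γ := γ) (x := x) (s := s) (b := b) (l := l b)
    (F := fun γ x s' => M.dualSup γ x s' (shiftMultiplier ν (s, b))) (G := M.dualInf)
    fun s' => by
      rw [shiftMultiplier_consMultiplier, dualSup_congr (μ' := μ b s')]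
      · exact (hlt b s').le
      · intro p t c hp
        simp only [glueMultiplier, hp]
  have h3 := mul_le_of_le_one_left hε.le hM.β_lt_one.le
  have h4 := h b hb
  refine h2.trans ?_
  linarith

/-- The value of `μ` at the first post-action history is the candidate for the inner infimum; the
rest of `μ` is a competitor in the continuation dual. -/
theorem stage_dualInf_le (hM : M.Assumptions) (γ : Fin I → ℝ≥0) {x : X} {s : S} {b : A}
    (hb : b ∈ M.allowed x s) {μ : Multiplier S A I} (hμ : FiniteDepth μ) :
    M.stage M.dualInf γ x s b (μ [] s b) ≤ M.dualSup γ x s μ :=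
  (stage_mono hM (G := fun γ x s' => M.dualSup γ x s' (shiftMultiplier μ (s, b)))
    fun s' => dualInf_le hM _ _ s' (hμ.shift _)).trans (stage_le_dualSup hM γ hμ.bdd hb)

/-- The dual value solves the functional equation. -/
theorem solvesSupInf_dualInf (hM : M.Assumptions) : M.SolvesSupInf M.dualInf := by
  intro γ x s
  change (M.dualInf γ x s : EReal) = ⨆ a ∈ M.allowed x s, ⨅ l : Fin I → ℝ≥0,
    ((M.stage M.dualInf γ x s a l : ℝ) : EReal)
  refine le_antisymm (le_of_not_gt fun hlt => ?_)
    (iSup₂_le fun b hb => le_of_not_gt fun hlt => ?_)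
  · obtain ⟨v, hv1, hv2⟩ := EReal.lt_iff_exists_real_btwn.1 hlt
    -- This is the exchange of infimum and supremum: a separate `l` for each action is together a
    -- single admissible choice of action-dependent multipliers. Disallowed actions get the dummy
    -- value `0`.
    have : ∀ b, ∃ l : Fin I → ℝ≥0, b ∈ M.allowed x s → M.stage M.dualInf γ x s b l < v := by
      intro b
      by_cases hb : b ∈ M.allowed x s
      · have := (le_iSup₂ (f := fun b (_ : b ∈ M.allowed x s) => ⨅ l : Fin I → ℝ≥0,
          ((M.stage M.dualInf γ x s b l : ℝ) : EReal)) b hb).trans_lt hv1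
        obtain ⟨l, hl⟩ := iInf_lt_iff.1 this
        exact ⟨l, fun _ => EReal.coe_lt_coe_iff.1 hl⟩
      · exact ⟨0, fun h => absurd h hb⟩
    choose l hl using this
    exact absurd (dualInf_le_of_stage_le hM fun b hb => (hl b hb).le)
      (not_le.2 (EReal.coe_lt_coe_iff.1 hv2))
  · obtain ⟨v, hv1, hv2⟩ := EReal.lt_iff_exists_real_btwn.1 hlt
    obtain ⟨μ, hμ, hlt'⟩ := exists_lt_of_dualInf_lt (EReal.coe_lt_coe_iff.1 hv1)
    have := EReal.coe_lt_coe_iff.1 (hv2.trans_le (iInf_le _ (μ [] s b)))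
    linarith [stage_dualInf_le hM γ hb hμ]

/-! ### The largest solution of the functional equation -/

/-- The supremum over the finite, nonempty set of allowed actions is attained, so one action serves
all `l` simultaneously. -/
theorem SolvesSupInf.exists_le_stage (hM : M.Assumptions) {G : (Fin I → ℝ≥0) → X → S → ℝ}
    (hG : M.SolvesSupInf G) (γ : Fin I → ℝ≥0) (x : X) (s : S) :
    ∃ b ∈ M.allowed x s, ∀ l, G γ x s ≤ M.stage G γ x s b l := by
  obtain ⟨a, ha, -⟩ := hM.feasible x
  have : Nonempty (M.allowed x s) := ⟨⟨a [] s, ha [] s⟩⟩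
  have h := hG γ x s
  rw [iSup_subtype'] at h
  obtain ⟨b, hb⟩ := exists_eq_ciSup_of_finite (f := fun b : M.allowed x s =>
    ⨅ l : Fin I → ℝ≥0, ((M.stage G γ x s b l : ℝ) : EReal))
  refine ⟨b, b.2, fun l => EReal.coe_le_coe_iff.1 ?_⟩
  refine (h.trans hb.symm).le.trans (iInf_le _ l)

/-- Taking `l = 0` keeps `γ` fixed, so `G` is a subsolution of an ordinary dynamic program. Its
excess over the value, bounded uniformly in the state, is multiplied by `β` at each iteration. -/
theorem SolvesSupInf.le_dualSup_zero (hM : M.Assumptions) {G : (Fin I → ℝ≥0) → X → S → ℝ}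
    (hG : M.SolvesSupInf G) (γ : Fin I → ℝ≥0) (hb : ∃ C, ∀ x s, G γ x s ≤ C) (x : X) (s : S) :
    G γ x s ≤ M.dualSup γ x s 0 := by
  have h0 : BddMultiplier (0 : Multiplier S A I) := finiteDepth_zero.bdd
  obtain ⟨C, hC⟩ := hb
  obtain ⟨K, hK⟩ := exists_abs_lagrangian_le hM γ h0
  have key : ∀ n : ℕ, ∀ x s, G γ x s ≤ M.dualSup γ x s 0 + M.β ^ n * (C + K) := by
    intro n
    induction n with
    | zero =>
      intro x s
      obtain ⟨a, ha, -⟩ := hM.feasible x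
      have h1 := lagrangian_le_dualSup hM γ s h0 ha
      have h2 := (abs_le.1 (hK x s a)).1
      have h3 := hC x s
      simp only [pow_zero, one_mul]
      linarith
    | succ n ih =>
      intro x s
      obtain ⟨b, hb, hl⟩ := hG.exists_le_stage hM γ x s
      have h1 := stage_le_dualSup hM γ h0 hb
      have h2 := stage_le_add hM (γ := γ) (x := x) (s := s) (b := b) (l := 0) (F := G)
        (G := fun γ x s' => M.dualSup γ x s' 0) (ε := M.β ^ n * (C + K))
        fun s' => by rw [add_zero]; exact ih _ _
      refine (hl 0).trans (h2.trans ?_)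
      rw [pow_succ', mul_assoc]
      exact add_le_add_left h1 _
  have hlim := ((tendsto_pow_atTop_nhds_zero_of_lt_one hM.β_pos.le hM.β_lt_one).mul_const
    (C + K)).const_add (M.dualSup γ x s 0)
  rw [zero_mul, add_zero] at hlim
  exact ge_of_tendsto' hlim fun n => key n x s

/-- Induction on the depth: inserting the first-period multiplier for `l` leaves a shifted
multiplier of smaller depth, at new weights. Hence `γ`, `x` and `s` vary in the induction, and an
upper bound is needed at every `γ`. -/
theorem SolvesSupInf.le_dualSup (hM : M.Assumptions) {G : (Fin I → ℝ≥0) → X → S → ℝ}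
    (hG : M.SolvesSupInf G) (hb : ∀ γ, ∃ C, ∀ x s, G γ x s ≤ C) {μ : Multiplier S A I}
    (hμ : FiniteDepth μ) (γ : Fin I → ℝ≥0) (x : X) (s : S) : G γ x s ≤ M.dualSup γ x s μ := by
  obtain ⟨T, hT⟩ := hμ
  induction T generalizing μ γ x s with
  | zero =>
    have : μ = 0 := funext fun p => funext fun t => funext fun b => hT p t b (Nat.zero_le _)
    rw [this]
    exact hG.le_dualSup_zero hM γ (hb γ) x s
  | succ T ih =>
    obtain ⟨b, hbx, hl⟩ := hG.exists_le_stage hM γ x s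
    refine (hl (μ [] s b)).trans (le_trans ?_ (stage_le_dualSup hM γ (FiniteDepth.bdd ⟨_, hT⟩) hbx))
    refine stage_mono hM fun s' => ih (μ := shiftMultiplier μ (s, b)) _ _ _ fun p t c hp =>
      hT _ _ _ ?_
    simpa using hp

theorem SolvesSupInf.le_dualInf (hM : M.Assumptions) {G : (Fin I → ℝ≥0) → X → S → ℝ}
    (hG : M.SolvesSupInf G) (hb : ∀ γ, ∃ C, ∀ x s, G γ x s ≤ C)
    (γ : Fin I → ℝ≥0) (x : X) (s : S) : G γ x s ≤ M.dualInf γ x s :=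
  Model.le_dualInf fun _ hμ => hG.le_dualSup hM hb hμ γ x s

end Dual

/-! ### Truncation of multipliers -/

theorem realized_injective (a : Plan S A) : Function.Injective (realized a) :=
  Function.LeftInverse.injective (g := List.map Prod.fst) (realized_map_fst a)

/-- The multipliers that agree with `μ` in the first `T` periods and vanish afterwards. -/
def truncate (μ : Multiplier S A I) (T : ℕ) : Multiplier S A I :=
  fun p s b => if p.length < T then μ p s b else 0

theorem finiteDepth_truncate (μ : Multiplier S A I) (T : ℕ) : FiniteDepth (truncate μ T) :=
  ⟨T, fun p s b hp => by simp [truncate, hp]⟩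

/-! ### Sums over histories -/

section Truncation

variable [Fintype S] {M : Model S A X I}

/-- The lists of shocks of length `n`. -/
def histories (S : Type*) [Fintype S] (n : ℕ) : Finset (List S) :=
  (List.finite_length_eq S n).toFinset

@[simp] theorem mem_histories {n : ℕ} {q : List S} : q ∈ histories S n ↔ q.length = n := by
  simp [histories]

theorem sum_histories_succ (n : ℕ) (f : List S → ℝ) :
    ∑ q ∈ histories S (n + 1), f q = ∑ q ∈ histories S n, ∑ s, f (s :: q) := by
  rw [← Finset.sum_product']
  symm
  refine Finset.sum_bij (fun z _ => z.2 :: z.1) ?_ ?_ ?_ ?_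
  · rintro ⟨q, s⟩ h
    simpa using h
  · rintro ⟨q, s⟩ _ ⟨q', s'⟩ _ h
    simp at h
    simp [h]
  · intro q hq
    cases q with
    | nil => simp at hq
    | cons s q => exact ⟨(q, s), by simpa using hq, rfl⟩
  · intro z _
    rfl

/-- The definition peels off the first step of the expectation; here the last step is peeled off, in
line with the recursion of `histProb`. -/
theorem expAfter_succ (f : List S → S → ℝ) (n : ℕ) (past : List S) (s : S) :
    M.expAfter f (n + 1) past s
      = M.expAfter (fun p t => ∑ s', M.π t s' * f (t :: p) s') n past s := by
  induction n generalizing past s with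
  | zero => rfl
  | succ n ih =>
    rw [expAfter]
    simp only [ih]
    rfl

theorem expAfter_eq_sum (f : List S → S → ℝ) (n : ℕ) (s₀ : S) :
    M.expAfter f n [] s₀ = ∑ q ∈ histories S n, ∑ s, M.histProb s₀ q s * f q s := by
  induction n generalizing f with
  | zero =>
    have : histories S 0 = {[]} := by
      ext q
      simp
    classical
    rw [this, Finset.sum_singleton, Finset.sum_eq_single s₀]
    · simp [expAfter, histProb]
    · intro s _ hs
      simp [histProb, hs]
    · simp
  | succ n ih =>
    rw [expAfter_succ, ih, sum_histories_succ]
    simp only [Finset.mul_sum, histProb, mul_assoc]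

theorem histProb_nonneg (hM : M.Assumptions) (s₀ : S) (past : List S) (s : S) :
    0 ≤ M.histProb s₀ past s := by
  induction past generalizing s with
  | nil => simp only [histProb]; split_ifs <;> norm_num
  | cons q past ih => exact mul_nonneg (ih q) (hM.π_pos _ _).le

theorem histProb_pos (hM : M.Assumptions) {s₀ : S} {past : List S} {s : S}
    (h : past.getLastD s = s₀) : 0 < M.histProb s₀ past s := by
  induction past generalizing s with
  | nil => simp_all [histProb]
  | cons q past ih =>
    rw [List.getLastD_cons] at h
    exact mul_pos (ih h) (hM.π_pos _ _)

/-- A plan realizes just one post-action history over each shock history, so its period-`n` penalty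
is at most a slack bound times the period-`n` layer of the summable series. The layer does not
depend on the plan. -/
theorem exists_penalty_bound (hM : M.Assumptions) {s₀ : S} {μ : Multiplier S A I}
    (hμ : μ ∈ M.summableMultipliers s₀) :
    ∃ W : ℕ → ℝ, Summable W ∧ ∀ a x n,
      |M.β ^ n * M.expAfter (M.penalty a x μ) n [] s₀| ≤ W n := by
  classical
  obtain ⟨C, hC0, hC⟩ := exists_abs_slack_le hM
  set φ : List (S × A) × S × A × Fin I → ℝ := fun h =>
    M.β ^ h.1.length * (μ h.1 h.2.1 h.2.2.1 h.2.2.2 : ℝ) *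
      M.histProb s₀ (h.1.map Prod.fst) h.2.1 with hφ
  have hφs : Summable φ := hμ
  have hφ0 : ∀ h, 0 ≤ φ h := fun h => mul_nonneg (mul_nonneg (pow_nonneg hM.β_pos.le _)
    (NNReal.coe_nonneg _)) (histProb_nonneg hM _ _ _)
  set fib : ℕ → Set (List (S × A) × S × A × Fin I) :=
    fun n => (fun h => h.1.length) ⁻¹' {n} with hfib
  have hW : Summable fun n => ∑' h : fib n, φ h :=
    (hφs.hasSum.tsum_fiberwise fun h => h.1.length).summable
  refine ⟨fun n => C * ∑' h : fib n, φ h, hW.mul_left C, fun a x n => ?_⟩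
  rw [expAfter_eq_sum, Finset.mul_sum]
  have hterm : ∀ q ∈ histories S n, |M.β ^ n * ∑ s, M.histProb s₀ q s * M.penalty a x μ q s|
      ≤ C * ∑ s, ∑ i, φ (realized a q, s, a q s, i) := by
    intro q hq
    rw [mem_histories] at hq
    simp only [penalty, Finset.mul_sum]
    refine (Finset.abs_sum_le_sum_abs _ _).trans (Finset.sum_le_sum fun s _ =>
      (Finset.abs_sum_le_sum_abs _ _).trans (Finset.sum_le_sum fun i _ => ?_))
    have h1 : |M.β ^ n * (M.histProb s₀ q s *
        ((μ (realized a q) s (a q s) i : ℝ) * M.slack i a x q s))|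
        = φ (realized a q, s, a q s, i) * |M.slack i a x q s| := by
      rw [← abs_of_nonneg (hφ0 (realized a q, s, a q s, i)), ← abs_mul]
      simp only [hφ, length_realized, realized_map_fst, hq]
      congr 1
      ring
    rw [h1, mul_comm]
    exact mul_le_mul_of_nonneg_right (hC _ _ _ _ _) (hφ0 _)
  refine (Finset.abs_sum_le_sum_abs _ _).trans ((Finset.sum_le_sum hterm).trans ?_)
  rw [← Finset.mul_sum]
  refine mul_le_mul_of_nonneg_left ?_ hC0
  rw [tsum_subtype]
  -- The histories realized under `a` embed into all post-action histories, so the finite sum is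
  -- part of the layer's series of nonnegative terms.
  let e : List S × S × Fin I ↪ List (S × A) × S × A × Fin I :=
    ⟨fun z => (realized a z.1, z.2.1, a z.1 z.2.1, z.2.2), by
      rintro ⟨q, s, i⟩ ⟨q', s', i'⟩ h
      simp only [Prod.mk.injEq] at h
      simp [realized_injective a h.1, h.2.1, h.2.2.2]⟩
  calc ∑ q ∈ histories S n, ∑ s, ∑ i, φ (realized a q, s, a q s, i)
      = ∑ z ∈ histories S n ×ˢ (Finset.univ : Finset (S × Fin I)), (fib n).indicator φ (e z) := by
        rw [Finset.sum_product]
        refine Finset.sum_congr rfl fun q hq => ?_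
        rw [mem_histories] at hq
        rw [Fintype.sum_prod_type]
        refine Finset.sum_congr rfl fun s _ => Finset.sum_congr rfl fun i _ => ?_
        rw [Set.indicator_of_mem]
        · rfl
        · exact (length_realized a q).trans hq
    _ = ∑ z ∈ (histories S n ×ˢ (Finset.univ : Finset (S × Fin I))).map e,
          (fib n).indicator φ z := by rw [Finset.sum_map]
    _ ≤ _ := (hφs.indicator _).sum_le_tsum _ fun z _ => Set.indicator_nonneg (fun z _ => hφ0 z) z

theorem expAfter_truncate (a : Plan S A) (x : X) (μ : Multiplier S A I) (T n : ℕ) (s₀ : S) :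
    M.expAfter (M.penalty a x (truncate μ T)) n [] s₀
      = if n < T then M.expAfter (M.penalty a x μ) n [] s₀ else 0 := by
  simp only [expAfter_eq_sum]
  split_ifs with h
  · refine Finset.sum_congr rfl fun q hq => Finset.sum_congr rfl fun s _ => ?_
    rw [mem_histories] at hq
    simp [penalty, truncate, length_realized, hq, h]
  · refine Finset.sum_eq_zero fun q hq => Finset.sum_eq_zero fun s _ => ?_
    rw [mem_histories] at hq
    simp [penalty, truncate, length_realized, hq, h]

/-- One tail of the summable bound controls the discarded penalties of all plans, so `T` can be
chosen before the plan. -/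
theorem exists_lagrangian_truncate_le [Finite A] (hM : M.Assumptions) (γ : Fin I → ℝ≥0) (x : X)
    {s₀ : S} {μ : Multiplier S A I} (hμ : μ ∈ M.summableMultipliers s₀) {ε : ℝ} (hε : 0 < ε) :
    ∃ T, ∀ a, M.lagrangian γ x s₀ a (truncate μ T) ≤ M.lagrangian γ x s₀ a μ + ε := by
  obtain ⟨W, hW, hbd⟩ := exists_penalty_bound hM hμ
  obtain ⟨T, hT⟩ := ((tendsto_sum_nat_add W).eventually_lt_const hε).exists
  refine ⟨T, fun a => ?_⟩
  have hs : Summable fun n => M.β ^ n * M.expAfter (M.penalty a x μ) n [] s₀ :=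
    Summable.of_norm_bounded hW (hbd a x)
  have hsT : Summable fun n => M.β ^ n * M.expAfter (M.penalty a x (truncate μ T)) n [] s₀ :=
    summable_discounted hM (penalty_isBdd hM a x (finiteDepth_truncate μ T).bdd) [] s₀
  -- A summable multiplier may be unbounded, so `lagrangian_eq` does not apply; the splitting uses
  -- summability from `s₀` instead.
  have hlag : M.lagrangian γ x s₀ a μ
      = M.objective γ x s₀ a + M.discounted (M.penalty a x μ) [] s₀ := by
    have hadd := (summable_discounted hM (along_isBdd (M := M) (payoff_bdd hM γ) a x) [] s₀).tsum_add hs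
    simp only [← mul_add, ← expAfter_add] at hadd
    exact hadd
  rw [lagrangian_eq hM γ x s₀ a (finiteDepth_truncate μ T).bdd, hlag]
  have h1 : M.discounted (M.penalty a x (truncate μ T)) [] s₀
      = ∑ n ∈ Finset.range T, M.β ^ n * M.expAfter (M.penalty a x μ) n [] s₀ := by
    rw [discounted, ← hsT.sum_add_tsum_nat_add T]
    simp only [expAfter_truncate]
    simp only [not_lt.2 (Nat.le_add_left T _), if_false, mul_zero, tsum_zero, add_zero]
    refine Finset.sum_congr rfl fun n hn => ?_
    rw [if_pos (Finset.mem_range.1 hn)]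
  have h2 : M.discounted (M.penalty a x μ) [] s₀
      = ∑ n ∈ Finset.range T, M.β ^ n * M.expAfter (M.penalty a x μ) n [] s₀
        + ∑' n, M.β ^ (n + T) * M.expAfter (M.penalty a x μ) (n + T) [] s₀ :=
    (hs.sum_add_tsum_nat_add T).symm
  have h3 : ‖∑' n, M.β ^ (n + T) * M.expAfter (M.penalty a x μ) (n + T) [] s₀‖
      ≤ ∑' n, W (n + T) :=
    tsum_of_norm_bounded ((summable_nat_add_iff T).2 hW).hasSum fun n => hbd a x (n + T)
  have h4 := (abs_le.1 h3).1
  rw [h1, h2]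
  linarith

theorem FiniteDepth.mem_summableMultipliers [Finite A] {μ : Multiplier S A I}
    (hμ : FiniteDepth μ) (s₀ : S) : μ ∈ M.summableMultipliers s₀ := by
  refine summable_of_hasFiniteSupport (hμ.finite_support.subset fun h hh hz => hh ?_)
  simp [hz]

/-- Multipliers of finite depth suffice in the dual problem. -/
theorem dualValue_eq [Finite A] (hM : M.Assumptions) (γ : Fin I → ℝ≥0) (x : X) (s : S) :
    M.dualValue γ x s = M.dualInf γ x s := by
  refine le_antisymm (le_of_not_gt fun hlt => ?_) (le_iInf₂ fun μ hμ => le_of_not_gt fun hlt => ?_)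
  · obtain ⟨v, hv1, hv2⟩ := EReal.lt_iff_exists_real_btwn.1 hlt
    obtain ⟨μ, hμ, hlt'⟩ := exists_lt_of_dualInf_lt (EReal.coe_lt_coe_iff.1 hv1)
    have h1 : M.dualValue γ x s ≤ (M.dualSup γ x s μ : EReal) :=
      (iInf₂_le μ (hμ.mem_summableMultipliers s)).trans (iSup₂_le fun a ha =>
        EReal.coe_le_coe_iff.2 (lagrangian_le_dualSup hM γ s hμ.bdd ha))
    exact absurd (EReal.coe_lt_coe_iff.1 (hv2.trans_le h1)) (not_lt.2 hlt'.le)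
  · obtain ⟨v, hv1, hv2⟩ := EReal.lt_iff_exists_real_btwn.1 hlt
    refine absurd (EReal.coe_lt_coe_iff.1 hv2) (not_lt.2 (le_of_forall_pos_le_add fun ε hε => ?_))
    obtain ⟨T, hT⟩ := exists_lagrangian_truncate_le hM γ x hμ hε
    have := admissible_nonempty hM x
    refine (dualInf_le hM γ x s (finiteDepth_truncate μ T)).trans (ciSup_le fun a => ?_)
    have h1 := (le_iSup₂ (f := fun a (_ : a ∈ M.admissible x) =>
      (M.lagrangian γ x s a μ : EReal)) a.1 a.2).trans_lt hv1
    linarith [hT a, EReal.coe_lt_coe_iff.1 h1]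

end Truncation

end Model

/-! ### Separation by a probability measure -/

open CompactlySupported in
/-- If no function in a convex set of continuous functions on a compact space is negative
everywhere, then all of them have a nonnegative integral for some probability measure. -/
theorem exists_probabilityMeasure_forall_integral_nonneg {K : Type*} [TopologicalSpace K]
    [CompactSpace K] [T2Space K] [MeasurableSpace K] [BorelSpace K] {C : Set C(K, ℝ)}
    (hC : Convex ℝ C) (hne : C.Nonempty) (h : ∀ f ∈ C, ∃ x, 0 ≤ f x) :
    ∃ P : ProbabilityMeasure K, ∀ f ∈ C, 0 ≤ ∫ x, f x ∂(P : Measure K) := by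
  set N : Set C(K, ℝ) := {f | ∀ x, f x < 0} with hN
  have hNc : Convex ℝ N := by
    intro f hf g hg a b ha hb hab x
    have h1 := hf x
    have h2 := hg x
    simp only [ContinuousMap.add_apply, ContinuousMap.smul_apply, smul_eq_mul]
    rcases ha.eq_or_lt with rfl | ha
    · rw [zero_add] at hab
      simp [hab, h2]
    · nlinarith
  have hNo : IsOpen N := by
    have := ContinuousMap.isOpen_setOfPred_mapsTo (X := K) isCompact_univ (isOpen_Iio (a := (0 : ℝ)))
    simpa [Set.MapsTo, hN] using this
  have hd : Disjoint N C := Set.disjoint_left.2 fun f hf hfC => by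
    obtain ⟨x, hx⟩ := h f hfC
    exact absurd (hf x) (not_lt.2 hx)
  obtain ⟨l, u, hl, hu⟩ := geometric_hahn_banach_open hNc hNo hC hd
  have hNs : ∀ f ∈ N, ∀ t : ℝ, 0 < t → t • f ∈ N := fun f hf t ht x => by
    simpa using mul_neg_of_pos_of_neg ht (hf x)
  have hone : (-1 : C(K, ℝ)) ∈ N := fun x => by simp
  have hNl : ∀ f ∈ N, l f ≤ 0 := by
    intro f hf
    by_contra! hpos
    -- The scaling brings the value of `l` up to `|u| + 1`, beyond the separating level `u`.
    have h1 := hl _ (hNs f hf ((|u| + 1) / l f) (by positivity))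
    rw [map_smul, smul_eq_mul, div_mul_cancel₀ _ hpos.ne'] at h1
    linarith [le_abs_self u]
  have hu0 : 0 ≤ u := by
    by_contra! hneg
    have h0 := hNl _ hone
    -- If `u < 0`, a small multiple of `-1` has an `l`-value above `u`. The extra `- 1` keeps the
    -- denominator negative even if `l (-1) = 0`.
    have h1 := hl _ (hNs _ hone (u / (2 * (l (-1) - 1))) (div_pos_of_neg_of_neg hneg (by linarith)))
    rw [map_smul, smul_eq_mul, div_mul_eq_mul_div, div_lt_iff_of_neg (by linarith)] at h1
    nlinarith
  have hpos : ∀ f : C(K, ℝ), (∀ x, 0 ≤ f x) → 0 ≤ l f := by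
    intro f hf
    -- Only strictly negative functions lie in `N`, so `-f` is approached by `-f - ε`.
    have h1 : ∀ ε : ℝ, 0 < ε → l (-f) + ε * l (-1) ≤ 0 := by
      intro ε hε
      have : -f + ε • (-1 : C(K, ℝ)) ∈ N := fun x => by
        have := hf x
        simp
        linarith
      simpa using hNl _ this
    have h2 : l (-f) ≤ 0 := by
      refine le_of_forall_pos_le_add fun δ hδ => ?_
      have h3 := h1 (δ / (|l (-1)| + 1)) (by positivity)
      have h4 : δ / (|l (-1)| + 1) * |l (-1)| ≤ δ := by
        rw [div_mul_eq_mul_div, div_le_iff₀ (by positivity)]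
        nlinarith
      have h5 : δ / (|l (-1)| + 1) * (-|l (-1)|) ≤ δ / (|l (-1)| + 1) * l (-1) :=
        mul_le_mul_of_nonneg_left (neg_abs_le _) (by positivity)
      linarith
    simpa using h2
  -- If `l 1 = 0`, positivity forces `l f ≤ 0` for a chosen `f ∈ C`, whence `u ≤ 0`, while `l (-1) =
  -- 0 < u`. Nonemptiness of `C` enters here.
  have hl1 : 0 < l 1 := by
    refine lt_of_le_of_ne (hpos 1 fun x => by simp) fun h0 => ?_
    obtain ⟨f, hf⟩ := hne
    have hbd : l f ≤ 0 := by
      have := hpos (‖f‖ • 1 - f) fun x => by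
        have := (le_abs_self _).trans (f.norm_coe_le_norm x)
        simpa using this
      rw [map_sub, map_smul, ← h0] at this
      simpa using this
    have h1 := hl _ hone
    have h2 := hu f hf
    rw [map_neg, ← h0] at h1
    linarith
  let Λ₀ : C_c(K, ℝ) →ₗ[ℝ] ℝ :=
    { toFun := fun f => (l 1)⁻¹ * l f.toContinuousMap
      map_add' := fun f g => by
        rw [← mul_add, ← map_add]
        rfl
      map_smul' := fun c f => by
        rw [RingHom.id_apply, smul_eq_mul, mul_left_comm, ← smul_eq_mul c, ← map_smul]
        rfl }
  let Λ : C_c(K, ℝ) →ₚ[ℝ] ℝ := PositiveLinearMap.mk₀ Λ₀ fun f hf =>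
    mul_nonneg (inv_nonneg.2 hl1.le) (hpos _ fun x => hf x)
  have hint : ∀ f : C(K, ℝ), ∫ x, f x ∂(RealRMK.rieszMeasure Λ) = (l 1)⁻¹ * l f := fun f =>
    RealRMK.integral_rieszMeasure Λ (CompactlySupportedContinuousMap.continuousMapEquiv f)
  have hfin : IsFiniteMeasure (RealRMK.rieszMeasure Λ) := inferInstance
  have hprob : IsProbabilityMeasure (RealRMK.rieszMeasure Λ) := by
    have h1 := hint 1
    rw [inv_mul_cancel₀ hl1.ne'] at h1
    simp only [ContinuousMap.one_apply, integral_const, smul_eq_mul, mul_one, measureReal_def] at h1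
    exact ⟨by rw [← ENNReal.ofReal_toReal (measure_ne_top _ _), h1, ENNReal.ofReal_one]⟩
  refine ⟨⟨RealRMK.rieszMeasure Λ, hprob⟩, fun f hf => ?_⟩
  change 0 ≤ ∫ x, f x ∂(RealRMK.rieszMeasure Λ)
  rw [hint]
  exact mul_nonneg (inv_nonneg.2 hl1.le) (hu0.trans (hu f hf))

namespace Model
variable {S A X : Type*} {I : ℕ}

/-! ### Continuity in the plan -/

section Discounted

variable [Fintype S] {M : Model S A X I}

theorem continuous_expAfter {Ω : Type*} [TopologicalSpace Ω] {F : Ω → List S → S → ℝ}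
    (hF : ∀ p t, Continuous fun a => F a p t) (n : ℕ) (past : List S) (s : S) :
    Continuous fun a => M.expAfter (F a) n past s := by
  induction n generalizing past s with
  | zero => exact hF _ _
  | succ n ih => exact continuous_finsetSum _ fun t _ => continuous_const.mul (ih _ _)

/-- The Weierstrass test applies, with a geometric majorant uniform over `Ω`. -/
theorem continuous_discounted (hM : M.Assumptions) {Ω : Type*} [TopologicalSpace Ω]
    {F : Ω → List S → S → ℝ} (hF : ∀ p t, Continuous fun a => F a p t) {C : ℝ}
    (hC : ∀ a p t, |F a p t| ≤ C) (past : List S) (s : S) :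
    Continuous fun a => M.discounted (F a) past s :=
  continuous_tsum (fun n => continuous_const.mul (continuous_expAfter hF n past s))
    (hasSum_geometric_bound hM C).summable fun n a => abs_discounted_term_le hM (hC a) past s n

end Discounted

section Continuity

variable {M : Model S A X I} [TopologicalSpace A] [DiscreteTopology A]

/-- At a fixed history only finitely many coordinates of the plan matter, and actions are discrete;
giving `X` the discrete topology makes every map of state and action continuous. -/
theorem continuous_along (f : X → A → S → ℝ) (x : X) (past : List S) (s : S) :
    Continuous fun a : Plan S A => M.along f a x past s := by
  let _ : TopologicalSpace X := ⊥
  have _ : DiscreteTopology X := ⟨rfl⟩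
  have hst : Continuous fun a : Plan S A => M.state a x past := by
    induction past with
    | nil => exact continuous_const
    | cons q past ih =>
      exact (continuous_of_discreteTopology (f := fun z : X × A => M.ζ z.1 z.2 q)).comp
        (ih.prodMk (continuous_apply_apply past q))
  exact (continuous_of_discreteTopology (f := fun z : X × A => f z.1 z.2 s)).comp
    (hst.prodMk (continuous_apply_apply past s))

theorem continuous_realized (φ : List (S × A) → A → ℝ) (past past' : List S) (s : S) :
    Continuous fun a : Plan S A => φ (realized a past) (a past' s) := by
  let _ : TopologicalSpace (List (S × A)) := ⊥
  have _ : DiscreteTopology (List (S × A)) := ⟨rfl⟩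
  have hre : Continuous fun a : Plan S A => realized a past := by
    induction past with
    | nil => exact continuous_const
    | cons q past ih =>
      exact (continuous_of_discreteTopology
        (f := fun z : List (S × A) × A => (q, z.2) :: z.1)).comp
        (ih.prodMk (continuous_apply_apply past q))
  exact (continuous_of_discreteTopology (f := fun z : List (S × A) × A => φ z.1 z.2)).comp
    (hre.prodMk (continuous_apply_apply past' s))

theorem isClosed_admissible (x : X) : IsClosed (M.admissible x) := by
  have : M.admissible x = ⋂ (past : List S) (s : S), {a | 0 ≤ M.along M.p a x past s} := by
    ext a
    simp only [Set.mem_iInter]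
    rfl
  rw [this]
  exact isClosed_iInter fun past => isClosed_iInter fun s =>
    isClosed_le continuous_const (continuous_along _ x past s)

variable [Fintype S]

theorem continuous_slack (hM : M.Assumptions) (i : Fin I) (x : X) (past : List S) (s : S) :
    Continuous fun a : Plan S A => M.slack i a x past s := by
  obtain ⟨C, hC⟩ := hM.g_bdd i
  exact (continuous_discounted hM (fun p t => continuous_along _ x p t)
    (fun a p t => hC _ _ _) past s).sub (continuous_along _ x past s)

theorem continuous_penalty (hM : M.Assumptions) (x : X) (μ : Multiplier S A I) (past : List S)
    (s : S) : Continuous fun a : Plan S A => M.penalty a x μ past s :=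
  continuous_finsetSum _ fun i _ =>
    (continuous_realized (fun p b => (μ p s b i : ℝ)) past past s).mul
      (continuous_slack hM i x past s)

theorem continuous_objective (hM : M.Assumptions) (γ : Fin I → ℝ≥0) (x : X) (s : S) :
    Continuous fun a : Plan S A => M.objective γ x s a := by
  obtain ⟨C, hC⟩ := payoff_bdd hM γ
  exact continuous_discounted hM (fun p t => continuous_along _ x p t) (fun a p t => hC _ _ _) _ _

theorem continuous_lagrangian (hM : M.Assumptions) (γ : Fin I → ℝ≥0) (x : X) (s : S)
    {μ : Multiplier S A I} (hμ : BddMultiplier μ) :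
    Continuous fun a : Plan S A => M.lagrangian γ x s a μ := by
  obtain ⟨K, hK⟩ := exists_abs_penalty_le hM hμ
  simp only [lagrangian_eq hM γ x s _ hμ]
  exact (continuous_objective hM γ x s).add (continuous_discounted hM
    (fun p t => continuous_penalty hM x μ p t) (fun a p t => hK a x p t) _ _)

end Continuity

/-! ### The constraints of the ex-post problem -/

open Classical in
/-- The integrand of the ex-post constraint. -/
def constraint [Fintype S] (M : Model S A X I) (i : Fin I) (past : List (S × A)) (s : S) (b : A)
    (x : X) (a : Plan S A) : ℝ :=
  if Follows a past s b then M.slack i a x (past.map Prod.fst) s else 0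

theorem continuous_constraint [Fintype S] [TopologicalSpace A] [DiscreteTopology A]
    {M : Model S A X I} (hM : M.Assumptions) (i : Fin I) (past : List (S × A)) (s : S) (b : A)
    (x : X) : Continuous (M.constraint i past s b x) := by
  classical
  have h := (continuous_realized (fun q c => if q = past ∧ c = b then (1 : ℝ) else 0)
    (past.map Prod.fst) (past.map Prod.fst) s).mul (continuous_slack hM i x (past.map Prod.fst) s)
  refine h.congr fun a => ?_
  simp only [constraint, Follows, Pi.mul_apply, ite_mul, one_mul, zero_mul]
  congr

open Classical in
/-- The multiplier that is `c` for the constraint `i` at one post-action history. -/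
def singleMultiplier (i : Fin I) (past : List (S × A)) (s : S) (b : A) (c : ℝ≥0) :
    Multiplier S A I :=
  fun p t b' j => if p = past ∧ t = s ∧ b' = b ∧ j = i then c else 0

theorem finiteDepth_singleMultiplier (i : Fin I) (past : List (S × A)) (s : S) (b : A) (c : ℝ≥0) :
    FiniteDepth (singleMultiplier i past s b c) := by
  refine ⟨past.length + 1, fun p t b' hp => funext fun j => if_neg ?_⟩
  rintro ⟨rfl, -⟩
  omega

open Classical in
-- Pricing one post-action history concentrates the penalty at one shock history, where it is a
-- multiple of the integrand of that ex-post constraint.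
theorem penalty_singleMultiplier [Fintype S] {M : Model S A X I} (i : Fin I)
    (past : List (S × A)) (s : S) (b : A) (c : ℝ≥0) (x : X) (a : Plan S A) :
    M.penalty a x (singleMultiplier i past s b c) = fun q t =>
      if q = past.map Prod.fst ∧ t = s then c * M.constraint i past s b x a else 0 := by
  funext q t
  by_cases h : q = past.map Prod.fst ∧ t = s
  · obtain ⟨rfl, rfl⟩ := h
    rw [penalty, Finset.sum_eq_single i]
    · by_cases hf : Follows a past t b
      · simp [singleMultiplier, constraint, hf, hf.1, hf.2]
      · have : ¬ (realized a (past.map Prod.fst) = past ∧ a (past.map Prod.fst) t = b) := hf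
        simp [singleMultiplier, constraint, hf, this]
    · intro j _ hj
      simp [singleMultiplier, hj]
    · simp
  · rw [if_neg h]
    refine Finset.sum_eq_zero fun j _ => ?_
    rw [singleMultiplier, if_neg]
    · simp
    · rintro ⟨h1, h2, -⟩
      exact h ⟨by rw [← h1, realized_map_fst], h2⟩

open Classical in
theorem discounted_single [Fintype S] {M : Model S A X I} (q : List S) (s s₀ : S) (v : ℝ) :
    M.discounted (fun p t => if p = q ∧ t = s then v else 0) [] s₀
      = M.β ^ q.length * M.histProb s₀ q s * v := by
  rw [discounted, tsum_eq_single q.length]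
  · rw [expAfter_eq_sum, Finset.sum_eq_single q, Finset.sum_eq_single s]
    · simp [mul_assoc]
    · intro t _ ht
      simp [ht]
    · simp
    · intro p _ hp
      simp [hp]
    · simp
  · intro n hn
    rw [expAfter_eq_sum, Finset.sum_eq_zero, mul_zero]
    intro p hp
    rw [mem_histories] at hp
    refine Finset.sum_eq_zero fun t _ => ?_
    rw [if_neg, mul_zero]
    rintro ⟨rfl, -⟩
    exact hn hp.symm

/-! ### Strong duality -/

theorem finite_map_fst_eq [Finite S] [Finite A] (q : List S) :
    {p : List (S × A) | p.map Prod.fst = q}.Finite :=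
  (List.finite_length_eq (S × A) q.length).subset fun p hp => by
    rw [Set.mem_ofPred_eq] at hp ⊢
    rw [← hp, List.length_map]

/-- Lets a multiplier grow without bound, isolating its constraint from the objective. -/
theorem nonneg_of_forall_nat_mul_add {u w : ℝ} (h : ∀ n : ℕ, 0 ≤ u + n * w) : 0 ≤ w := by
  by_contra! hw
  obtain ⟨n, hn⟩ := exists_nat_gt (u / -w)
  rw [div_lt_iff₀ (by linarith)] at hn
  linarith [h n]

theorem compactSpace_admissible {M : Model S A X I} [Finite A] [TopologicalSpace A]
    [DiscreteTopology A] (x : X) : CompactSpace (M.admissible x) :=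
  isCompact_iff_compactSpace.1 (isClosed_admissible x).isCompact

section Duality

variable [Fintype S] {M : Model S A X I}

theorem lagrangian_zero (γ : Fin I → ℝ≥0) (x : X) (s : S) (a : Plan S A) :
    M.lagrangian γ x s a 0 = M.objective γ x s a := by
  simp [lagrangian, objective]

/-- Only the realized post-action history contributes. The sum is linear in the constraint
integrands, so ex-post feasibility makes its integral nonnegative. -/
theorem penalty_eq_sum [Fintype A] (x : X) (μ : Multiplier S A I) (q : List S) (s : S)
    (a : Plan S A) :
    M.penalty a x μ q s = ∑ i, ∑ z ∈ (finite_map_fst_eq q).toFinset ×ˢ Finset.univ,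
      (μ z.1 s z.2 i : ℝ) * M.constraint i z.1 s z.2 x a := by
  refine Finset.sum_congr rfl fun i _ => ?_
  rw [Finset.sum_eq_single (realized a q, a q s)]
  · simp [constraint, Follows, realized_map_fst]
  · rintro ⟨p, b⟩ hp hne
    have hp' : p.map Prod.fst = q := by simpa using hp
    rw [constraint, if_neg, mul_zero]
    rintro ⟨h1, h2⟩
    rw [hp'] at h1 h2
    exact hne (by rw [h1, h2])
  · simp [realized_map_fst]

theorem integral_expAfter_nonneg (hM : M.Assumptions) {Ω : Type*} [MeasurableSpace Ω]
    {P : Measure Ω} {F : Ω → List S → S → ℝ} (hF : ∀ p t, Integrable (fun a => F a p t) P)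
    (h0 : ∀ p t, 0 ≤ ∫ a, F a p t ∂P) (n : ℕ) (past : List S) (s : S) :
    Integrable (fun a => M.expAfter (F a) n past s) P ∧
      0 ≤ ∫ a, M.expAfter (F a) n past s ∂P := by
  induction n generalizing past s with
  | zero => exact ⟨hF _ _, h0 _ _⟩
  | succ n ih =>
    simp only [expAfter]
    refine ⟨integrable_finsetSum _ fun t _ => (ih _ _).1.const_mul _, ?_⟩
    rw [integral_finsetSum _ fun t _ => (ih _ _).1.const_mul _]
    refine Finset.sum_nonneg fun t _ => ?_
    rw [integral_const_mul]
    exact mul_nonneg (hM.π_pos _ _).le (ih _ _).2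

theorem integral_discounted_nonneg (hM : M.Assumptions) {Ω : Type*} [MeasurableSpace Ω]
    {P : Measure Ω} [IsProbabilityMeasure P] {F : Ω → List S → S → ℝ} {C : ℝ}
    (hC : ∀ a p t, |F a p t| ≤ C) (hF : ∀ p t, Integrable (fun a => F a p t) P)
    (h0 : ∀ p t, 0 ≤ ∫ a, F a p t ∂P) (past : List S) (s : S) :
    0 ≤ ∫ a, M.discounted (F a) past s ∂P := by
  have hE := integral_expAfter_nonneg hM hF h0
  have hi : ∀ n, Integrable (fun a => M.β ^ n * M.expAfter (F a) n past s) P :=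
    fun n => (hE n past s).1.const_mul _
  have hs : Summable fun n => ∫ a, ‖M.β ^ n * M.expAfter (F a) n past s‖ ∂P := by
    refine Summable.of_norm_bounded (hasSum_geometric_bound hM C).summable fun n => ?_
    have := norm_integral_le_of_norm_le_const (μ := P)
      (f := fun a => ‖M.β ^ n * M.expAfter (F a) n past s‖) (C := M.β ^ n * C)
      (Filter.Eventually.of_forall fun a => by
        rw [norm_norm]; exact abs_discounted_term_le hM (hC a) past s n)
    simpa using this
  simp only [discounted]
  rw [← integral_tsum_of_summable_integral_norm hi hs]
  refine tsum_nonneg fun n => ?_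
  rw [integral_const_mul]
  exact mul_nonneg (pow_nonneg hM.β_pos.le n) (hE n past s).2

variable [Finite A]

/-- The continuous functions `L(·, μ) - v + e`, where `e` is nonnegative at all plans that agree
with `f` unless the first shock is `s`. -/
def lagrangianPlusNonneg [TopologicalSpace A] (M : Model S A X I) (γ : Fin I → ℝ≥0) (x : X) (s : S) (f : Plan S A) (v : ℝ) :
    Set C(M.admissible x, ℝ) :=
  {h | ∃ μ : Multiplier S A I, FiniteDepth μ ∧ ∃ e : M.admissible x → ℝ,
    (∀ a : M.admissible x, (∀ p t, p.getLastD t ≠ s → a.1 p t = f p t) → 0 ≤ e a) ∧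
    ∀ a, h a = M.lagrangian γ x s a.1 μ - v + e a}

/-- For a fixed plan the Lagrangian is affine in the multiplier, and convex combinations preserve
finite depth and the sign condition on `e`. -/
theorem convex_lagrangianPlusNonneg [TopologicalSpace A] (hM : M.Assumptions) (γ : Fin I → ℝ≥0) (x : X) (s : S)
    (f : Plan S A) (v : ℝ) : Convex ℝ (M.lagrangianPlusNonneg γ x s f v) := by
  rintro h ⟨μ, hμ, e, he, hh⟩ h' ⟨μ', hμ', e', he', hh'⟩ c d hc hd hcd
  set ν : Multiplier S A I := fun p t b i => c.toNNReal * μ p t b i + d.toNNReal * μ' p t b i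
    with hνd
  have hν : FiniteDepth ν := by
    obtain ⟨T, hT⟩ := hμ
    obtain ⟨T', hT'⟩ := hμ'
    exact ⟨max T T', fun p t b hp => funext fun i => by
      simp [hνd, hT p t b ((le_max_left _ _).trans hp), hT' p t b ((le_max_right _ _).trans hp)]⟩
  refine ⟨ν, hν, fun a => c * e a + d * e' a, fun a ha => add_nonneg (mul_nonneg hc (he a ha))
    (mul_nonneg hd (he' a ha)), fun a => ?_⟩
  have hpen : M.penalty a.1 x ν
      = fun p t => c * M.penalty a.1 x μ p t + d * M.penalty a.1 x μ' p t := by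
    funext p t
    simp only [penalty, hνd, NNReal.coe_add, NNReal.coe_mul, Real.coe_toNNReal _ hc,
      Real.coe_toNNReal _ hd, Finset.mul_sum, ← Finset.sum_add_distrib]
    exact Finset.sum_congr rfl fun i _ => by ring
  have h1 := penalty_isBdd hM a.1 x hμ.bdd
  have h2 := penalty_isBdd hM a.1 x hμ'.bdd
  simp only [ContinuousMap.add_apply, ContinuousMap.smul_apply, smul_eq_mul, hh, hh']
  rw [lagrangian_eq hM γ x s _ hμ.bdd, lagrangian_eq hM γ x s _ hμ'.bdd,
    lagrangian_eq hM γ x s _ hν.bdd, hpen, discounted_add hM (h1.const_mul c) (h2.const_mul d),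
    discounted_const_mul, discounted_const_mul]
  linear_combination (M.objective γ x s a.1 - v) * hcd

section Topology

variable [TopologicalSpace A] [DiscreteTopology A]

/-- Compactness provides a true maximizer, needed because the separation argument asks for a point
with value at least `0`. -/
theorem exists_lagrangian_eq_dualSup (hM : M.Assumptions) (γ : Fin I → ℝ≥0) (x : X) (s : S)
    {μ : Multiplier S A I} (hμ : FiniteDepth μ) :
    ∃ a ∈ M.admissible x, M.lagrangian γ x s a μ = M.dualSup γ x s μ := by
  have hne := admissible_nonempty hM x
  obtain ⟨a, ha, hmax⟩ := (isClosed_admissible (M := M) x).isCompact.exists_isMaxOn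
    (Set.nonempty_coe_sort.1 hne) (continuous_lagrangian hM γ x s hμ.bdd).continuousOn
  exact ⟨a, ha, le_antisymm (lagrangian_le_dualSup hM γ s hμ.bdd ha)
    (ciSup_le fun a' => hmax a'.2)⟩

variable [MeasurableSpace A] [DiscreteMeasurableSpace A]

theorem integrable_of_continuous {x : X} {f : Plan S A → ℝ} (hf : Continuous f)
    (P : ProbabilityMeasure (M.admissible x)) :
    Integrable (fun a : M.admissible x => f a) (P : Measure (M.admissible x)) := by
  have := compactSpace_admissible (M := M) x
  exact (hf.comp continuous_subtype_val).integrable_of_hasCompactSupport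
    (HasCompactSupport.of_compactSpace _)

/-- Weak duality: under an ex-post feasible lottery the expected penalty is nonnegative, so the
expected objective is at most the expected Lagrangian. -/
theorem integral_objective_le_dualSup (hM : M.Assumptions) (γ : Fin I → ℝ≥0) (x : X) (s : S)
    {P : ProbabilityMeasure (M.admissible x)} (hP : M.ExPostFeasible x P)
    {μ : Multiplier S A I} (hμ : FiniteDepth μ) :
    ∫ a : M.admissible x, M.objective γ x s a.1 ∂(P : Measure (M.admissible x))
      ≤ M.dualSup γ x s μ := by
  have := Fintype.ofFinite A
  obtain ⟨K, hK⟩ := exists_abs_penalty_le hM hμ.bdd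
  have hc : ∀ i p t b, 0 ≤ ∫ a : M.admissible x, M.constraint i p t b x a.1
      ∂(P : Measure (M.admissible x)) := hP
  have hpen : 0 ≤ ∫ a : M.admissible x, M.discounted (M.penalty a.1 x μ) [] s
      ∂(P : Measure (M.admissible x)) := by
    refine integral_discounted_nonneg hM (F := fun a : M.admissible x => M.penalty a.1 x μ)
      (fun a p t => hK a.1 x p t)
      (fun p t => integrable_of_continuous (continuous_penalty hM x μ p t) P) (fun p t => ?_) [] s
    simp only [penalty_eq_sum]
    have hint : ∀ i (z : List (S × A) × A), Integrable (fun a : M.admissible x =>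
        (μ z.1 t z.2 i : ℝ) * M.constraint i z.1 t z.2 x a.1) (P : Measure (M.admissible x)) :=
      fun i z => (integrable_of_continuous (continuous_constraint hM i z.1 t z.2 x) P).const_mul _
    rw [integral_finsetSum _ fun i _ => integrable_finsetSum _ fun z _ => hint i z]
    refine Finset.sum_nonneg fun i _ => ?_
    rw [integral_finsetSum _ fun z _ => hint i z]
    refine Finset.sum_nonneg fun z _ => ?_
    rw [integral_const_mul]
    exact mul_nonneg (NNReal.coe_nonneg _) (hc _ _ _ _)
  have hobj := integrable_of_continuous (continuous_objective hM γ x s) P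
  have hpi : Integrable (fun a : M.admissible x => M.discounted (M.penalty a.1 x μ) [] s)
      (P : Measure (M.admissible x)) :=
    integrable_of_continuous (f := fun a => M.discounted (M.penalty a x μ) [] s)
      (continuous_discounted hM (fun p t => continuous_penalty hM x μ p t)
        (fun a p t => hK a x p t) _ _) P
  have hle : ∫ a : M.admissible x, M.lagrangian γ x s a.1 μ ∂(P : Measure (M.admissible x))
      ≤ M.dualSup γ x s μ := by
    have := integral_mono (integrable_of_continuous (continuous_lagrangian hM γ x s hμ.bdd) P)
      (integrable_const (M.dualSup γ x s μ)) fun a => lagrangian_le_dualSup hM γ s hμ.bdd a.2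
    simpa using this
  simp only [lagrangian_eq hM γ x s _ hμ.bdd] at hle
  rw [integral_add hobj hpi] at hle
  linarith

/-- Strong duality: the separating measure for `lagrangianPlusNonneg` at level `dualInf` is itself
the optimal lottery. -/
theorem exists_exPostFeasible_dualInf_le (hM : M.Assumptions) (γ : Fin I → ℝ≥0) (x : X) (s : S) :
    ∃ P : ProbabilityMeasure (M.admissible x), M.ExPostFeasible x P ∧ M.dualInf γ x s
      ≤ ∫ a : M.admissible x, M.objective γ x s a.1 ∂(P : Measure (M.admissible x)) := by
  classical
  have := compactSpace_admissible (M := M) x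
  obtain ⟨f, hf⟩ := hM.feasible x
  set v := M.dualInf γ x s
  have hmk : ∀ {φ : Plan S A → ℝ} (_ : Continuous φ), ∃ h : C(M.admissible x, ℝ),
      ∀ a, h a = φ a.1 := fun {φ} hφ => ⟨⟨_, hφ.comp continuous_subtype_val⟩, fun _ => rfl⟩
  have hobj := continuous_objective hM γ x s
  have hL0 : ∀ a, M.lagrangian γ x s a 0 = M.objective γ x s a := lagrangian_zero γ x s
  obtain ⟨P, hP⟩ := exists_probabilityMeasure_forall_integral_nonneg
    (convex_lagrangianPlusNonneg hM γ x s f v)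
    (by
      obtain ⟨h, hh⟩ := hmk (hobj.sub (continuous_const (y := v)))
      exact ⟨h, 0, finiteDepth_zero, 0, fun _ _ => le_rfl, fun a => by simp [hh, hL0]⟩)
    (by
      rintro h ⟨μ, hμ, e, he, hh⟩
      obtain ⟨a, ha, hmax⟩ := exists_lagrangian_eq_dualSup hM γ x s hμ
      -- Follow the maximizer after `s` and `f` after any other first shock. The Lagrangian at `s`
      -- is unchanged, and `e` is nonnegative at such a plan.
      set c : S → Plan S A := Function.update (fun _ => f) s a with hc
      have hca : gluePlan c ∈ M.admissible x := gluePlan_admissible fun t => by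
        rcases eq_or_ne t s with rfl | ht
        · simpa [hc] using ha
        · simpa [hc, ht] using hf.1
      refine ⟨⟨gluePlan c, hca⟩, ?_⟩
      rw [hh]
      refine add_nonneg (sub_nonneg.2 ?_) (he _ fun p t hp => ?_)
      · have h1 : M.lagrangian γ x s (gluePlan c) μ = M.lagrangian γ x s a μ :=
          lagrangian_congr (fun p t hp => by rw [gluePlan_eq c s p t hp]; simp [hc])
            (fun _ _ _ _ => rfl) γ x
        rw [h1, hmax]
        exact dualInf_le hM γ x s hμ
      · simp only [gluePlan, hc, Function.update_of_ne hp])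
  have hP' : ∀ φ : Plan S A → ℝ, Continuous φ → ∀ μ : Multiplier S A I, FiniteDepth μ →
      ∀ e : M.admissible x → ℝ,
      (∀ a : M.admissible x, (∀ p t, p.getLastD t ≠ s → a.1 p t = f p t) → 0 ≤ e a) →
      (∀ a : M.admissible x, φ a = M.lagrangian γ x s a.1 μ - v + e a) →
      0 ≤ ∫ a : M.admissible x, φ a ∂(P : Measure (M.admissible x)) := by
    intro φ hφ μ hμ e he heq
    obtain ⟨h, hh⟩ := hmk hφ
    have := hP h ⟨μ, hμ, e, he, fun a => (hh a).trans (heq a)⟩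
    simpa only [hh] using this
  have hoi := integrable_of_continuous hobj P
  have hov : Integrable (fun a : M.admissible x => M.objective γ x s a.1 - v)
      (P : Measure (M.admissible x)) := hoi.sub (integrable_const v)
  refine ⟨P, fun i past t b => ?_, ?_⟩
  · have hcc := continuous_constraint hM i past t b x
    change 0 ≤ ∫ a : M.admissible x, M.constraint i past t b x a.1 ∂(P : Measure (M.admissible x))
    have hci := integrable_of_continuous hcc P
    by_cases ht : (past.map Prod.fst).getLastD t = s
    · set κ := M.β ^ past.length * M.histProb s (past.map Prod.fst) t with hκ
      -- Histories starting at `s` have positive probability, so the factor in front of the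
      -- constraint can be cancelled.
      have hκ0 : 0 < κ := mul_pos (pow_pos hM.β_pos _) (histProb_pos hM ht)
      have key := fun n : ℕ => hP' (fun a => (M.objective γ x s a - v)
        + n * (κ * M.constraint i past t b x a))
        ((hobj.sub continuous_const).add (continuous_const.mul (continuous_const.mul hcc)))
        (singleMultiplier i past t b n) (finiteDepth_singleMultiplier _ _ _ _ _) 0
        (fun _ _ => le_rfl) (fun a => by
          rw [lagrangian_eq hM γ x s _ (finiteDepth_singleMultiplier _ _ _ _ _).bdd,
            penalty_singleMultiplier, discounted_single]
          simp only [hκ, List.length_map, Pi.zero_apply, NNReal.coe_natCast]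
          ring)
      have h2 := nonneg_of_forall_nat_mul_add
        (u := ∫ a : M.admissible x, (M.objective γ x s a.1 - v) ∂(P : Measure (M.admissible x)))
        (w := κ * ∫ a : M.admissible x, M.constraint i past t b x a.1
          ∂(P : Measure (M.admissible x))) fun n => by
        rw [← integral_const_mul, ← integral_const_mul, ← integral_add hov
          ((hci.const_mul _).const_mul _)]
        exact key n
      exact nonneg_of_mul_nonneg_right h2 hκ0
    -- These histories start at another shock and have probability zero. The constraint enters
    -- through `e`, which is legitimate because plans agreeing with the feasible `f` there have
    -- nonnegative slack.
    · have key := fun n : ℕ => hP' (fun a => (M.objective γ x s a - v)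
        + n * M.constraint i past t b x a)
        ((hobj.sub continuous_const).add (continuous_const.mul hcc)) 0 finiteDepth_zero
        (fun a => n * M.constraint i past t b x a) (fun a ha => by
          refine mul_nonneg n.cast_nonneg ?_
          rw [constraint]
          split_ifs
          · rw [slack_congr (s₀ := (past.map Prod.fst).getLastD t) (a' := f)
              (fun p t' hp => ha p t' (hp ▸ ht)) i x _ t rfl]
            exact hf.2 _ _ _
          · exact le_rfl) (fun a => by rw [hL0])
      refine nonneg_of_forall_nat_mul_add
        (u := ∫ a : M.admissible x, (M.objective γ x s a.1 - v) ∂(P : Measure (M.admissible x)))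
        fun n => ?_
      rw [← integral_const_mul, ← integral_add hov (hci.const_mul _)]
      exact key n
  -- The zero multiplier leaves the objective minus `v`, giving the value.
  · have key := hP' (fun a => M.objective γ x s a - v) (hobj.sub continuous_const) 0
      finiteDepth_zero 0 (fun _ _ => le_rfl) (fun a => by simp [hL0])
    rw [integral_sub hoi (integrable_const v)] at key
    simpa using key

end Topology

variable [MeasurableSpace A] [DiscreteMeasurableSpace A]

/-- The maximum of the ex-post lottery problem is attained and equals the dual value. -/
theorem isGreatest_exPostValues (hM : M.Assumptions) (γ : Fin I → ℝ≥0) (x : X) (s : S) :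
    IsGreatest (M.exPostValues γ x s) (M.dualInf γ x s) := by
  let _ : TopologicalSpace A := ⊥
  have _ : DiscreteTopology A := ⟨rfl⟩
  have hle : ∀ P : ProbabilityMeasure (M.admissible x), M.ExPostFeasible x P →
      ∫ a : M.admissible x, M.objective γ x s a.1 ∂(P : Measure (M.admissible x))
        ≤ M.dualInf γ x s := fun P hP =>
    le_dualInf fun μ hμ => integral_objective_le_dualSup hM γ x s hP hμ
  obtain ⟨P, hP, hge⟩ := exists_exPostFeasible_dualInf_le hM γ x s
  refine ⟨⟨P, hP, le_antisymm hge (hle P hP)⟩, ?_⟩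
  rintro _ ⟨Q, hQ, rfl⟩
  exact hle Q hQ

end Duality

/-! ### The dual value belongs to the class `𝓝` -/

theorem supNorm_nonneg (f : X → A → S → ℝ) : 0 ≤ supNorm f :=
  Real.iSup_nonneg fun _ => abs_nonneg _

theorem abs_le_supNorm {f : X → A → S → ℝ} (hf : ∃ C : ℝ, ∀ x a s, |f x a s| ≤ C)
    (x : X) (a : A) (s : S) : |f x a s| ≤ supNorm f := by
  obtain ⟨C, hC⟩ := hf
  refine le_ciSup (f := fun z : X × A × S => |f z.1 z.2.1 z.2.2|) ⟨C, ?_⟩ (x, a, s)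
  rintro _ ⟨z, rfl⟩
  exact hC _ _ _

section Class

variable [Fintype S] {M : Model S A X I}

theorem lipConst_nonneg (hM : M.Assumptions) : 0 ≤ M.lipConst :=
  div_nonneg (add_nonneg (supNorm_nonneg _) (Finset.sum_nonneg fun _ _ => supNorm_nonneg _))
    (sub_nonneg.2 hM.β_lt_one.le)

theorem abs_discounted_r_le (hM : M.Assumptions) (a : Plan S A) (x : X) (s : S) :
    |M.discounted (M.along M.r a x) [] s| ≤ M.lipConst :=
  (abs_discounted_le hM (fun _ _ => abs_le_supNorm hM.r_bdd _ _ _) [] s).trans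
    (div_le_div_of_nonneg_right
      (le_add_of_nonneg_right (Finset.sum_nonneg fun _ _ => supNorm_nonneg _))
      (sub_nonneg.2 hM.β_lt_one.le))

theorem abs_discounted_g_le (hM : M.Assumptions) (i : Fin I) (a : Plan S A) (x : X) (s : S) :
    |M.discounted (M.along (M.g i) a x) [] s| ≤ M.lipConst :=
  (abs_discounted_le hM (fun _ _ => abs_le_supNorm (hM.g_bdd i) _ _ _) [] s).trans
    (div_le_div_of_nonneg_right
      ((Finset.single_le_sum (f := fun i => supNorm (M.g i)) (fun _ _ => supNorm_nonneg _)
        (Finset.mem_univ i)).trans (le_add_of_nonneg_left (supNorm_nonneg _)))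
      (sub_nonneg.2 hM.β_lt_one.le))

theorem abs_objective_le (hM : M.Assumptions) (γ : Fin I → ℝ≥0) (x : X) (s : S) (a : Plan S A) :
    |M.objective γ x s a| ≤ (1 + ∑ i, (γ i : ℝ)) * M.lipConst := by
  rw [objective_eq hM, add_mul, one_mul, Finset.sum_mul]
  refine (abs_add_le _ _).trans (add_le_add (abs_discounted_r_le hM a x s)
    ((Finset.abs_sum_le_sum_abs _ _).trans (Finset.sum_le_sum fun i _ => ?_)))
  rw [abs_mul, abs_of_nonneg (γ i).coe_nonneg]
  exact mul_le_mul_of_nonneg_left (abs_discounted_g_le hM i a x s) (γ i).coe_nonneg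

theorem objective_sub_le (hM : M.Assumptions) (γ γ' : Fin I → ℝ≥0) (x : X) (s : S)
    (a : Plan S A) : M.objective γ x s a
      ≤ M.objective γ' x s a + M.lipConst * ∑ i, |(γ i : ℝ) - (γ' i : ℝ)| := by
  rw [objective_eq hM, objective_eq hM, add_assoc, Finset.mul_sum, ← Finset.sum_add_distrib]
  refine add_le_add_right (Finset.sum_le_sum fun i _ => ?_) _
  have h1 : ((γ i : ℝ) - γ' i) * M.discounted (M.along (M.g i) a x) [] s
      ≤ |(γ i : ℝ) - γ' i| * M.lipConst := by
    refine (le_abs_self _).trans ?_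
    rw [abs_mul]
    exact mul_le_mul_of_nonneg_left (abs_discounted_g_le hM i a x s) (abs_nonneg _)
  linarith

theorem tsum_two_inv_pow_enumIndex_le {T : Type*} [Countable T] :
    ∑' t : T, (2⁻¹ : ℝ≥0∞) ^ (enumIndex T t + 1) ≤ 1 := by
  have hinj : Function.Injective (enumIndex T) := (exists_injective_nat T).choose_spec
  refine (ENNReal.tsum_comp_le_tsum_of_injective hinj fun n => (2⁻¹ : ℝ≥0∞) ^ (n + 1)).trans ?_
  rw [ENNReal.tsum_geometric_add_one, ENNReal.one_sub_inv_two, inv_inv]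
  exact (ENNReal.inv_mul_cancel (by norm_num) (by norm_num)).le

theorem measurableSet_box (k : ℕ) : MeasurableSet (box I k) := by
  have : box I k = ⋂ i, {γ : Fin I → ℝ≥0 | γ i ≤ k} := by
    ext γ
    simp [box]
  rw [this]
  exact MeasurableSet.iInter fun i => measurableSet_le (measurable_pi_apply i) measurable_const

/-- Continuous functions of linear growth belong to `𝓜`. -/
theorem mem_spaceM_of_abs_le [Countable X] {F : (Fin I → ℝ≥0) → X → S → ℝ} {L : ℝ} (hL : 0 ≤ L)
    (hF : ∀ x s, Continuous fun γ => F γ x s)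
    (hb : ∀ γ x s, |F γ x s| ≤ (1 + ∑ i, (γ i : ℝ)) * L) : F ∈ spaceM S X I := by
  have hbox : ∀ (k : ℕ) x s, ∀ᵐ γ ∂((orthantVolume I).restrict (box I (k + 1))),
      ‖F γ x s‖ ≤ ((k : ℝ) + 1) * ((1 + I) * L) := fun k x s => by
    refine ae_restrict_of_forall_mem (measurableSet_box _) fun γ hγ => (hb γ x s).trans ?_
    have h1 : ∑ i, (γ i : ℝ) ≤ ∑ _i : Fin I, ((k : ℝ) + 1) :=
      Finset.sum_le_sum fun i _ => by
        have := hγ i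
        exact_mod_cast this
    rw [Finset.sum_const, Finset.card_univ, Fintype.card_fin, nsmul_eq_mul] at h1
    rw [← mul_assoc]
    refine mul_le_mul_of_nonneg_right ?_ hL
    have : (0 : ℝ) ≤ k := k.cast_nonneg
    linarith
  refine ⟨fun k x s => memLp_top_of_bound (hF x s).aestronglyMeasurable _ (hbox k x s), ?_⟩
  -- Linear growth in `γ` gives linear growth of the box norms in `k`, which the weights `2⁻¹ ^ (k +
  -- 1)` make summable uniformly in `x` and `s`.
  set U : ℝ≥0∞ := ∑' k : ℕ, (2⁻¹ : ℝ≥0∞) ^ (k + 1) * ENNReal.ofReal (((k : ℝ) + 1) * ((1 + I) * L))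
    with hU
  have hUfin : U < ∞ := by
    have hsum : Summable fun k : ℕ =>
        (2⁻¹ : ℝ) ^ (k + 1) * (((k : ℝ) + 1) * ((1 + I) * L)) := by
      have h := (summable_nat_add_iff 1).2
        (summable_pow_mul_geometric_of_norm_lt_one 1 (r := (2⁻¹ : ℝ)) (by norm_num))
      refine (h.mul_right ((1 + I) * L)).congr fun k => ?_
      push_cast
      ring
    have heq : U = ∑' k : ℕ, ENNReal.ofReal
        ((2⁻¹ : ℝ) ^ (k + 1) * (((k : ℝ) + 1) * ((1 + I) * L))) := by
      refine tsum_congr fun k => ?_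
      rw [ENNReal.ofReal_mul (p := 2⁻¹ ^ (k + 1)) (by positivity), ENNReal.ofReal_pow (by norm_num),
        ENNReal.ofReal_inv_of_pos (by norm_num), ENNReal.ofReal_ofNat]
    rw [heq]
    exact hsum.tsum_ofReal_lt_top
  have hk : ∀ x s, ∑' k : ℕ, (2⁻¹ : ℝ≥0∞) ^ (k + 1) *
      eLpNorm (fun γ => F γ x s) ∞ ((orthantVolume I).restrict (box I (k + 1))) ≤ U := by
    refine fun x s => ENNReal.tsum_le_tsum fun k => ?_
    gcongr
    rw [eLpNorm_exponent_top]
    exact eLpNormEssSup_le_of_ae_bound (hbox k x s)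
  refine ENNReal.sum_lt_top.2 fun s _ => ENNReal.mul_lt_top (by simp) ?_
  calc _ ≤ ∑' x : X, (2⁻¹ : ℝ≥0∞) ^ (enumIndex X x + 1) * U :=
        ENNReal.tsum_le_tsum fun x => by gcongr; exact hk x s
    _ ≤ 1 * U := by
        rw [ENNReal.tsum_mul_right]
        gcongr
        exact tsum_two_inv_pow_enumIndex_le
    _ < ∞ := by rwa [one_mul]

variable [Finite A]

theorem objective_le_dualInf (hM : M.Assumptions) (γ : Fin I → ℝ≥0) {x : X} (s : S)
    {a : Plan S A} (ha : M.Feasible x a) : M.objective γ x s a ≤ M.dualInf γ x s :=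
  le_dualInf fun _ hμ => (objective_le_lagrangian hM γ s hμ.bdd ha).trans
    (lagrangian_le_dualSup hM γ s hμ.bdd ha.1)

theorem dualInf_le_add (hM : M.Assumptions) (γ γ' : Fin I → ℝ≥0) (x : X) (s : S) :
    M.dualInf γ x s ≤ M.dualInf γ' x s + M.lipConst * ∑ i, |(γ i : ℝ) - (γ' i : ℝ)| := by
  rw [← sub_le_iff_le_add]
  refine le_dualInf fun μ hμ => sub_le_iff_le_add.2 ((dualInf_le hM γ x s hμ).trans ?_)
  have := admissible_nonempty hM x
  refine ciSup_le fun a => ?_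
  have h1 := lagrangian_le_dualSup hM γ' s hμ.bdd a.2
  rw [lagrangian_eq hM _ _ _ _ hμ.bdd] at h1 ⊢
  linarith [objective_sub_le hM γ γ' x s a]

theorem abs_dualInf_sub_le (hM : M.Assumptions) (γ γ' : Fin I → ℝ≥0) (x : X) (s : S) :
    |M.dualInf γ x s - M.dualInf γ' x s| ≤ M.lipConst * ∑ i, |(γ i : ℝ) - (γ' i : ℝ)| := by
  have h1 := dualInf_le_add hM γ γ' x s
  have h2 := dualInf_le_add hM γ' γ x s
  simp only [abs_sub_comm (γ' _ : ℝ)] at h2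
  exact abs_le.2 ⟨by linarith, by linarith⟩

theorem abs_dualInf_le (hM : M.Assumptions) (γ : Fin I → ℝ≥0) (x : X) (s : S) :
    |M.dualInf γ x s| ≤ (1 + ∑ i, (γ i : ℝ)) * M.lipConst := by
  obtain ⟨f, hf⟩ := hM.feasible x
  have hle : M.dualSup γ x s 0 ≤ (1 + ∑ i, (γ i : ℝ)) * M.lipConst := by
    have := admissible_nonempty hM x
    refine ciSup_le fun a => ?_
    rw [lagrangian_zero]
    exact (abs_le.1 (abs_objective_le hM γ x s a)).2
  exact abs_le.2 ⟨(abs_le.1 (abs_objective_le hM γ x s f)).1.trans (objective_le_dualInf hM γ s hf),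
    (dualInf_le hM γ x s finiteDepth_zero).trans hle⟩

theorem continuous_dualInf (hM : M.Assumptions) (x : X) (s : S) :
    Continuous fun γ => M.dualInf γ x s := by
  refine continuous_iff_continuousAt.2 fun γ₀ => ?_
  refine tendsto_iff_norm_sub_tendsto_zero.2 (squeeze_zero (fun γ => norm_nonneg _)
    (fun γ => abs_dualInf_sub_le hM γ γ₀ x s) ?_)
  have : Continuous fun γ : Fin I → ℝ≥0 => M.lipConst * ∑ i, |(γ i : ℝ) - (γ₀ i : ℝ)| := by
    fun_prop
  simpa using this.tendsto γ₀

/-- By duality this is a maximum over lotteries whose feasibility does not involve `γ`, of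
objectives affine in `γ`. The topology and σ-algebra on `A` serve only this argument, as `dualInf`
mentions neither. -/
theorem convexOn_dualInf (hM : M.Assumptions) (x : X) (s : S) :
    ConvexOn ℝ≥0 Set.univ fun γ => M.dualInf γ x s := by
  let _ : TopologicalSpace A := ⊥
  have _ : DiscreteTopology A := ⟨rfl⟩
  let _ : MeasurableSpace A := ⊤
  refine ⟨convex_univ, fun γ _ γ' _ c d _ _ hcd => ?_⟩
  obtain ⟨⟨P, hP, hval⟩, -⟩ := isGreatest_exPostValues hM (c • γ + d • γ') x s
  have hi := integrable_of_continuous (continuous_objective hM γ x s) P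
  have hi' := integrable_of_continuous (continuous_objective hM γ' x s) P
  have hcd' : (c : ℝ) + d = 1 := by exact_mod_cast hcd
  have haff : ∀ a, M.objective (c • γ + d • γ') x s a
      = (c : ℝ) * M.objective γ x s a + (d : ℝ) * M.objective γ' x s a := by
    intro a
    simp only [objective_eq hM, Pi.add_apply, Pi.smul_apply, smul_eq_mul, NNReal.coe_add,
      NNReal.coe_mul, add_mul, Finset.sum_add_distrib, mul_add, Finset.mul_sum, mul_assoc]
    linear_combination -M.discounted (M.along M.r a x) [] s * hcd'
  simp only [haff] at hval
  rw [integral_add (hi.const_mul _) (hi'.const_mul _), integral_const_mul,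
    integral_const_mul] at hval
  simp only [NNReal.smul_def, smul_eq_mul]
  rw [hval]
  exact add_le_add
    (mul_le_mul_of_nonneg_left ((isGreatest_exPostValues hM γ x s).2 ⟨P, hP, rfl⟩) c.coe_nonneg)
    (mul_le_mul_of_nonneg_left ((isGreatest_exPostValues hM γ' x s).2 ⟨P, hP, rfl⟩) d.coe_nonneg)

theorem inN_dualInf [Countable X] (hM : M.Assumptions) : M.InN M.dualInf where
  mem_spaceM := mem_spaceM_of_abs_le (lipConst_nonneg hM) (continuous_dualInf hM)
    (abs_dualInf_le hM)
  convex := convexOn_dualInf hM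
  lipschitz x s γ γ' := abs_dualInf_sub_le hM γ γ' x s
  lower γ x s a ha := by
    rw [← objective_eq hM]
    exact objective_le_dualInf hM γ s ha
  upper γ x s := (le_abs_self _).trans (abs_dualInf_le hM γ x s)

end Class

end Model
end ForwardLooking
end

theorem mainTheorem2 {S A X : Type*} [Fintype S] [Finite A] [Countable X]
    [MeasurableSpace A] [DiscreteMeasurableSpace A] {I : ℕ}
    (M : ForwardLooking.Model S A X I) (hM : M.Assumptions) :
    (∀ (γ : Fin I → ℝ≥0) (x₀ : X) (s₀ : S), ∃ V : ℝ,
      IsGreatest (M.exPostValues γ x₀ s₀) V ∧ (V : EReal) = M.dualValue γ x₀ s₀) ∧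
    ∃ F : (Fin I → ℝ≥0) → X → S → ℝ,
      IsGreatest {G | M.InN G ∧ M.SolvesSupInf G} F ∧
      ∀ (γ : Fin I → ℝ≥0) (x₀ : X) (s₀ : S), IsGreatest (M.exPostValues γ x₀ s₀) (F γ x₀ s₀) := by
  refine ⟨fun γ x₀ s₀ => ⟨M.dualInf γ x₀ s₀, ForwardLooking.Model.isGreatest_exPostValues hM γ x₀ s₀,
    (ForwardLooking.Model.dualValue_eq hM γ x₀ s₀).symm⟩, M.dualInf,
    ⟨⟨ForwardLooking.Model.inN_dualInf hM, ForwardLooking.Model.solvesSupInf_dualInf hM⟩,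
      -- `upper` bounds `G` at each `γ` uniformly in state and shock, as the vanishing error `β ^ n`
      -- in `SolvesSupInf.le_dualSup_zero` requires.
      fun G hG γ x s => hG.2.le_dualInf hM (fun γ => ⟨_, fun x s => hG.1.upper γ x s⟩) γ x s⟩,
    ForwardLooking.Model.isGreatest_exPostValues hM⟩
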